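/- Let $S_\infty$ be the group of all permutations of $\mathbb{N}$ with the topology of pointwise convergence, and let $G\lneq S_\infty$ be a proper, closed subgroup acting transitively on $\mathbb{N}$. For finite $A\subseteq\mathbb{N}$ let $G_A$ be the pointwise stabilizer of $A$ in $G$. Assume that $G$ is *dynamically de Finetti*, that is: * (no algebraicity) for every finite $A\subseteq\mathbb{N}$, the points of $\mathbb{N}$ with finite $G_A$-orbit are exactly the elements of $A$; * (weak elimination of imaginaries) every open subgroup of $G$ contains, as a subgroup of finite index, $G_A$ for some finite $A\subseteq\mathbb{N}$; * for every p.m.p. action $G\curvearrowright(X,\nu)$ (a Borel action on a standard Borel space with a $G$-invariant Borel probability measure $\nu$) and all finite $A,B\subseteq\mathbb{N}$, the $\sigma$-algebras $\mathcal{F}_A$ and $\mathcal{F}_B$ are conditionally independent over $\mathcal{F}_{A\cap B}$, where $\mathcal{F}_A$ consists of the measurable $Y\subseteq X$ with $\nu(Y\triangle gY)=0$ for all $g\in G_A$. Let $\mathcal{L}_G$ be the canonical language of $G$, with one $n$-ary relation symbol for each orbit of the diagonal action $G\curvearrowright\mathbb{N}^n$, $n\ge 1$, and let $\mathbf{M}_G$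 be the canonical structure on $\mathbb{N}$, in which each symbol is interpreted as the corresponding orbit. Let $\mathcal{L}\supseteq\mathcal{L}_G$ be a countable relational language, and let $\mathrm{Struc}^G_{\mathcal{L}}$ be the space of $\mathcal{L}$-structures with domain $\mathbb{N}$ whose $\mathcal{L}_G$-reduct equals $\mathbf{M}_G$, with the topology inherited from $\prod_{R\in\mathcal{L}}\{0,1\}^{\mathbb{N}^{r_R}}$ ($r_R$ being the arity of $R$), on which $G$ acts by $R^{g\cdot\mathbf{M}}(\bar{x})\Leftrightarrow R^{\mathbf{M}}(g^{-1}\bar{x})$. Let $\mu$ be an ergodic invariant random expansion of $G$, that is, a $G$-invariant Borel probability measure on $\mathrm{Struc}^G_{\mathcal{L}}$ such that every measurable $Y$ with $\mu(Y\triangle gY)=0$ for all $g\in G$ is null or conull. Then either $\mathrm{Aut}(\mathbf{M})=\{1\}$ for $\mu$-a.e. $\mathbf{M}$, where $\mathrm{Aut}(\mathbf{M})=\{g\in S_\infty : g\cdot\mathbf{M}=\mathbf{M}\}$, or $\mu$ is concentrated on an orbit, that is, there is a $G$-orbit $O\subseteq\mathrm{Struc}^G_{\mathcal{L}}$ with $\mu(O)=1$.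 -/

import Mathlib

open MeasureTheory

namespace IRE

/-! ### The Polish group of all permutations of the natural numbers -/

/-- The topology of pointwise convergence on the group of permutations of `ℕ`
(where `ℕ` is discrete). Subgroups carry the subspace topology. -/
instance permTopology : TopologicalSpace (Equiv.Perm ℕ) :=
  TopologicalSpace.induced (fun (g : Equiv.Perm ℕ) (n : ℕ) => g n) inferInstance

/-- The Borel `σ`-algebra of the topology of pointwise convergence. -/
instance permMeasurableSpace : MeasurableSpace (Equiv.Perm ℕ) := borel _

instance permBorelSpace : BorelSpace (Equiv.Perm ℕ) := ⟨rfl⟩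

/-! ### Permutation groups -/

section Groups

variable (G : Subgroup (Equiv.Perm ℕ))

/-- The pointwise stabilizer `G_A` of a finite set `A ⊆ ℕ`, as a subgroup of `G`. -/
abbrev ptStab (A : Finset ℕ) : Subgroup G := fixingSubgroup G (A : Set ℕ)

/-- The algebraic closure of `A`: the points whose orbit under `G_A` is finite. -/
def acl (A : Finset ℕ) : Set ℕ := {x | (MulAction.orbit (ptStab G A) x).Finite}

/-- `G` has no algebraicity. -/
def NoAlgebraicity : Prop := ∀ A : Finset ℕ, acl G A = A

/-- `G` weakly eliminates imaginaries: every open subgroup of `G` contains some `G_A`, with `A`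
finite, as a finite index subgroup. -/
def WeakEliminationOfImaginaries : Prop :=
  ∀ V : Subgroup G, IsOpen (V : Set G) →
    ∃ A : Finset ℕ, ptStab G A ≤ V ∧ (ptStab G A).IsFiniteRelIndex V

/-- The `σ`-algebra `𝓕_A` of the measurable sets `Y` such that `Y` and `g • Y` agree up to
`μ`-measure zero for all `g ∈ G_A`. (These sets do form a `σ`-algebra, so there is no need to take
the generated one; as `g` ranges over a group one may use the preimages `g⁻¹ • Y`.) -/
@[reducible] def invSigma {X : Type} [MeasurableSpace X] [MulAction G X] (μ : Measure X)
    (A : Finset ℕ) : MeasurableSpace X where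
  MeasurableSet' Y := MeasurableSet Y ∧ ∀ g ∈ ptStab G A, (fun x => g • x) ⁻¹' Y =ᵐ[μ] Y
  measurableSet_empty := ⟨MeasurableSet.empty, fun _ _ => by simp⟩
  measurableSet_compl Y hY := ⟨hY.1.compl, fun g hg => (hY.2 g hg).compl⟩
  measurableSet_iUnion Y hY := ⟨MeasurableSet.iUnion fun i => (hY i).1, fun g hg => by
    rw [Set.preimage_iUnion]
    exact Filter.EventuallyEq.countable_iUnion fun i => (hY i).2 g hg⟩

theorem invSigma_le {X : Type} [m : MeasurableSpace X] [MulAction G X] (μ : Measure X)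
    (A : Finset ℕ) : invSigma G μ A ≤ m :=
  fun _ h => h.1

/-- `G` is dynamically de Finetti: it has no algebraicity, weakly eliminates imaginaries, and for
every p.m.p. action of `G` (a jointly Borel action on a standard Borel space with an invariant
Borel probability measure) and all finite `A, B ⊆ ℕ`, the `σ`-algebras `𝓕_A` and `𝓕_B` are
conditionally independent over `𝓕_{A ∩ B}`. -/
structure DynamicallyDeFinetti : Prop where
  noAlgebraicity : NoAlgebraicity G
  weakElimination : WeakEliminationOfImaginaries G
  condIndep : ∀ (X : Type) [MeasurableSpace X] [StandardBorelSpace X] [MulAction G X]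
    [MeasurableSMul₂ G X] (μ : Measure X) [IsProbabilityMeasure μ] [SMulInvariantMeasure G X μ]
    (A B : Finset ℕ),
    ProbabilityTheory.CondIndep (invSigma G μ (A ∩ B)) (invSigma G μ A) (invSigma G μ B)
      (invSigma_le G μ (A ∩ B)) μ

end Groups

/-! ### Structures with domain `ℕ` and the logic action -/

/-- The space `∏_R {0,1}^(ℕ^r)` of structures with domain `ℕ` in a relational language, the
product being over all relation symbols `R`, of arity `r`. -/
def Struc (L : FirstOrder.Language.{0, 0}) : Type :=
  ∀ (r : ℕ) (_ : L.Relations r), (Fin r → ℕ) → Bool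

namespace Struc

variable {L : FirstOrder.Language.{0, 0}}

/-- The product topology. -/
instance : TopologicalSpace (Struc L) :=
  inferInstanceAs (TopologicalSpace (∀ (r : ℕ) (_ : L.Relations r), (Fin r → ℕ) → Bool))

/-- The product `σ`-algebra. It is the Borel `σ`-algebra when the language is countable. -/
instance : MeasurableSpace (Struc L) :=
  inferInstanceAs (MeasurableSpace (∀ (r : ℕ) (_ : L.Relations r), (Fin r → ℕ) → Bool))

instance [∀ r, Countable (L.Relations r)] : BorelSpace (Struc L) :=
  inferInstanceAs (BorelSpace (∀ (r : ℕ) (_ : L.Relations r), (Fin r → ℕ) → Bool))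

/-- The logic action: `R` holds of `x` in `g • M` iff `R` holds of `g⁻¹ x` in `M`. -/
instance : MulAction (Equiv.Perm ℕ) (Struc L) where
  smul g M := fun r R x => M r R (fun i => g⁻¹ (x i))
  one_smul _ := rfl
  mul_smul g h M := by
    funext r R x
    change M r R _ = M r R _
    simp [mul_inv_rev]

theorem smul_apply (g : Equiv.Perm ℕ) (M : Struc L) (r : ℕ) (R : L.Relations r)
    (x : Fin r → ℕ) : (g • M) r R x = M r R (fun i => g⁻¹ (x i)) := rfl

/-- The automorphism group of a structure: its stabilizer, in the group of all permutations of
`ℕ`, for the logic action. -/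
def aut (M : Struc L) : Subgroup (Equiv.Perm ℕ) := MulAction.stabilizer (Equiv.Perm ℕ) M

end Struc

/-! ### The canonical structure of a permutation group and its expansions -/

section Expansions

variable (G : Subgroup (Equiv.Perm ℕ))

/-- The relation symbols of the canonical language: for each `n ≥ 1`, one `n`-ary symbol for each
orbit of the diagonal action of `G` on `ℕ^n`. -/
def CanonicalRel : ℕ → Type
  | 0 => Empty
  | n + 1 => MulAction.orbitRel.Quotient G (Fin (n + 1) → ℕ)

/-- The canonical language `L_G` of `G`. -/
def canonicalLanguage : FirstOrder.Language.{0, 0} where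
  Functions := fun _ => Empty
  Relations := CanonicalRel G

open Classical in
/-- The canonical structure `M_G`: the symbol of an orbit is interpreted by that orbit. -/
noncomputable def canonicalStructure : Struc (canonicalLanguage G)
  | 0, j, _ => Empty.elim j
  | n + 1, j, x =>
    decide (x ∈ MulAction.orbitRel.Quotient.orbit
      (j : MulAction.orbitRel.Quotient G (Fin (n + 1) → ℕ)))

variable {G} {L : FirstOrder.Language.{0, 0}}

/-- The `L_G`-reduct of an `L`-structure, where `L_G` is seen inside `L` through `φ`. -/
def reduct (φ : FirstOrder.Language.LHom (canonicalLanguage G) L) (M : Struc L) : Struc (canonicalLanguage G) :=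
  fun _ R => M _ (φ.onRelation R)

/-- The space of `G`-structures in the language `L`: the expansions of `M_G`, i.e. the structures
whose `L_G`-reduct is equal to `M_G`. It carries the subspace topology and `σ`-algebra. -/
def GStruc (φ : FirstOrder.Language.LHom (canonicalLanguage G) L) : Type :=
  {M : Struc L // reduct φ M = canonicalStructure G}

variable (φ : FirstOrder.Language.LHom (canonicalLanguage G) L)

instance : TopologicalSpace (GStruc φ) :=
  inferInstanceAs (TopologicalSpace {M : Struc L // reduct φ M = canonicalStructure G})

instance : MeasurableSpace (GStruc φ) :=
  inferInstanceAs (MeasurableSpace {M : Struc L // reduct φ M = canonicalStructure G})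

instance [∀ r, Countable (L.Relations r)] : BorelSpace (GStruc φ) :=
  inferInstanceAs (BorelSpace {M : Struc L // reduct φ M = canonicalStructure G})

theorem smul_canonicalStructure (g : G) :
    (g : Equiv.Perm ℕ) • canonicalStructure G = canonicalStructure G := by
  funext r R x
  rw [Struc.smul_apply]
  cases r with
  | zero => exact Empty.elim R
  | succ n =>
    simp only [canonicalStructure, decide_eq_decide]
    exact MulAction.orbitRel.Quotient.mem_orbit.trans
      (Iff.trans (by
        have : (Quotient.mk'' (fun i => (g : Equiv.Perm ℕ)⁻¹ (x i)) :
            MulAction.orbitRel.Quotient G (Fin (n + 1) → ℕ)) = Quotient.mk'' x :=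
          Quotient.sound' ⟨g⁻¹, rfl⟩
        rw [this]) MulAction.orbitRel.Quotient.mem_orbit.symm)

/-- The relativized logic action of `G` on the space of `G`-structures. -/
instance : MulAction G (GStruc φ) where
  smul g M := ⟨(g : Equiv.Perm ℕ) • M.1, by
    have h : reduct φ ((g : Equiv.Perm ℕ) • M.1) = (g : Equiv.Perm ℕ) • reduct φ M.1 := rfl
    rw [h, M.2, smul_canonicalStructure]⟩
  one_smul M := Subtype.ext (one_smul (Equiv.Perm ℕ) M.1)
  mul_smul g h M := Subtype.ext (mul_smul (g : Equiv.Perm ℕ) (h : Equiv.Perm ℕ) M.1)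

/-- An invariant random expansion of `G` in the language `L`: a Borel probability measure on the
space of `G`-structures which is invariant under the relativized logic action. -/
structure IsIRE (μ : Measure (GStruc φ)) : Prop where
  isProbabilityMeasure : IsProbabilityMeasure μ
  smulInvariant : SMulInvariantMeasure G (GStruc φ) μ

/-- `μ` is concentrated on an orbit: some `G`-orbit is conull. -/
def ConcentratedOnOrbit (μ : Measure (GStruc φ)) : Prop :=
  ∃ M : GStruc φ, ∀ᵐ N ∂μ, N ∈ MulAction.orbit G M

end Expansions

end IRE

namespace IRE

/-! ### Separating two points by a finite set that avoids both. -/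

section Separation

variable {G : Subgroup (Equiv.Perm ℕ)}

theorem mem_ptStab {A : Finset ℕ} {g : G} : g ∈ ptStab G A ↔ ∀ n ∈ A, g • n = n := by
  simp [ptStab, mem_fixingSubgroup_iff]

theorem ptStab_anti {A B : Finset ℕ} (h : A ⊆ B) : ptStab G B ≤ ptStab G A :=
  fun _ hg => mem_ptStab.2 fun n hn => mem_ptStab.1 hg n (h hn)

theorem continuous_apply_perm (n : ℕ) : Continuous fun g : Equiv.Perm ℕ => g n :=
  (continuous_apply n).comp continuous_induced_dom

theorem tendsto_perm_iff {ι : Type*} {l : Filter ι} {f : ι → Equiv.Perm ℕ} {h : Equiv.Perm ℕ} :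
    Filter.Tendsto f l (nhds h) ↔ ∀ n, ∀ᶠ i in l, f i n = h n := by
  rw [nhds_induced, Filter.tendsto_comap_iff, tendsto_pi_nhds]
  refine forall_congr' fun n => ?_
  rw [nhds_discrete, Filter.tendsto_pure]
  rfl

theorem mem_of_forall_finset (hclosed : IsClosed (G : Set (Equiv.Perm ℕ))) (h : Equiv.Perm ℕ)
    (hh : ∀ s : Finset ℕ, ∃ g ∈ G, ∀ n ∈ s, g n = h n) : h ∈ G := by
  choose g hg hgh using hh
  refine hclosed.mem_of_tendsto (f := g) (b := Filter.atTop) ?_ (Filter.Eventually.of_forall hg)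
  rw [tendsto_perm_iff]
  intro n
  filter_upwards [Filter.eventually_ge_atTop {n}] with s hs
  exact hgh s n (hs (by simp))

theorem infinite_orbit_of_notMem (hna : NoAlgebraicity G) {A : Finset ℕ} {x : ℕ} (hx : x ∉ A) :
    (MulAction.orbit (ptStab G A) x).Infinite := fun h => hx (by
  have : x ∈ acl G A := h
  rwa [hna A] at this)

/-- Points that are moved to each other by the stabilizer of any finite set avoiding them. -/
def Inseparable (G : Subgroup (Equiv.Perm ℕ)) (a b : ℕ) : Prop :=
  ∀ D : Finset ℕ, a ∉ D → b ∉ D → ∃ g ∈ ptStab G D, g • a = b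

theorem Inseparable.refl (a : ℕ) : Inseparable G a a := fun _ _ _ => ⟨1, one_mem _, one_smul _ _⟩

theorem Inseparable.symm {a b : ℕ} (h : Inseparable G a b) : Inseparable G b a := fun D hb ha => by
  obtain ⟨g, hg, rfl⟩ := h D ha hb
  exact ⟨g⁻¹, inv_mem hg, inv_smul_smul _ _⟩

theorem Inseparable.smul {a b : ℕ} (h : Inseparable G a b) (g : G) :
    Inseparable G (g • a) (g • b) := fun D ha hb => by
  classical
  obtain ⟨k, hk, rfl⟩ := h (D.image fun n => g⁻¹ • n)
    (fun h' => by
      obtain ⟨n, hn, rfl⟩ := Finset.mem_image.1 h'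
      exact ha (by simpa using hn))
    (fun h' => by
      obtain ⟨n, hn, rfl⟩ := Finset.mem_image.1 h'
      exact hb (by simpa using hn))
  refine ⟨g * k * g⁻¹, mem_ptStab.2 fun n hn => ?_, by simp [mul_smul]⟩
  have := mem_ptStab.1 hk (g⁻¹ • n) (Finset.mem_image_of_mem _ hn)
  rw [mul_smul, mul_smul, this, smul_inv_smul]

/-- The only obstruction is that b may lie in D. By no algebraicity the orbit of b over {a, c} is
infinite, so b can be replaced by a translate outside D. -/
theorem Inseparable.trans (hna : NoAlgebraicity G) {a b c : ℕ} (h₁ : Inseparable G a b)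
    (h₂ : Inseparable G b c) : Inseparable G a c := fun D ha hc => by
  classical
  by_cases hab : b = a
  · subst hab; exact h₂ D ha hc
  by_cases hcb : b = c
  · subst hcb; exact h₁ D ha hc
  obtain ⟨b', ⟨k, rfl⟩, hb'⟩ := (infinite_orbit_of_notMem hna (A := {a, c}) (x := b)
    (by simp [hab, hcb])).exists_notMem_finset D
  have hka : (k : G) • a = a := mem_ptStab.1 k.2 a (by simp)
  have hkc : (k : G) • c = c := mem_ptStab.1 k.2 c (by simp)
  have h₁' := h₁.smul (k : G)
  have h₂' := h₂.smul (k : G)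
  rw [hka] at h₁'
  rw [hkc] at h₂'
  obtain ⟨g, hg, hgb⟩ := h₁' D ha hb'
  obtain ⟨g', hg', hgc⟩ := h₂' D hb' hc
  exact ⟨g' * g, mul_mem hg' hg, by rw [mul_smul, hgb, hgc]⟩

/-- The stabilizer of the inseparability class of `a`. -/
def classStab (hna : NoAlgebraicity G) (a : ℕ) : Subgroup G where
  carrier := {g | Inseparable G a (g • a)}
  one_mem' := by simpa using Inseparable.refl a
  mul_mem' {g h} hg hh := by
    have := (show Inseparable G a (h • a) from hh).smul g
    rw [← mul_smul] at this
    exact Inseparable.trans hna hg this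
  inv_mem' {g} hg := by
    have := (show Inseparable G a (g • a) from hg).smul g⁻¹
    rw [inv_smul_smul] at this
    exact this.symm

theorem isOpen_classStab (hna : NoAlgebraicity G) (a : ℕ) :
    IsOpen (classStab hna a : Set G) :=
  (isOpen_discrete {n | Inseparable G a n}).preimage
    ((continuous_apply_perm a).comp continuous_subtype_val)

theorem finite_orbit_of_finiteIndex_stabilizer {Γ α : Type*} [Group Γ] [MulAction Γ α] {x : α}
    (h : (MulAction.stabilizer Γ x).FiniteIndex) : (MulAction.orbit Γ x).Finite :=
  have : Finite (Γ ⧸ MulAction.stabilizer Γ x) := inferInstance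
  have : Finite (MulAction.orbit Γ x) :=
    Finite.of_equiv _ (MulAction.orbitEquivQuotientStabilizer Γ x).symm
  Set.toFinite _

theorem finite_orbit_of_isFiniteRelIndex {A : Finset ℕ} {V : Subgroup G}
    (hfin : (ptStab G A).IsFiniteRelIndex V) {x : ℕ} (hx : x ∈ A) :
    (MulAction.orbit V x).Finite := by
  have h1 : ((ptStab G A).subgroupOf V).FiniteIndex := ⟨hfin.relIndex_ne_zero⟩
  have h2 : (ptStab G A).subgroupOf V ≤ MulAction.stabilizer V x := fun v hv =>
    mem_ptStab.1 (Subgroup.mem_subgroupOf.1 hv) x hx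
  exact finite_orbit_of_finiteIndex_stabilizer (Subgroup.finiteIndex_of_le h2)

/-- The stabilizer V of the class of a is open, so it contains some G_A with finite index. If A is
empty, then V = G and there is one class. Otherwise any x ∈ A has finite V-orbit, and V contains
G_a, so x = a by no algebraicity. The class of a is the V-orbit of a, hence finite, and the same
argument shows that each of its points is a. -/
theorem eq_or_forall_inseparable (htrans : MulAction.IsPretransitive G ℕ)
    (hna : NoAlgebraicity G) (hwei : WeakEliminationOfImaginaries G) (a : ℕ) :
    (∀ b, Inseparable G a b → b = a) ∨ ∀ b, Inseparable G a b := by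
  classical
  obtain ⟨A, hle, hfin⟩ := hwei _ (isOpen_classStab hna a)
  rcases A.eq_empty_or_nonempty with rfl | ⟨x, hx⟩
  · right
    intro b
    obtain ⟨g, rfl⟩ := MulAction.exists_smul_eq G a b
    exact hle (mem_ptStab.2 (by simp))
  · left
    have hsub : ptStab G {a} ≤ classStab hna a := fun g hg => by
      change Inseparable G a (g • a)
      rw [mem_ptStab.1 hg a (by simp)]
      exact Inseparable.refl a
    have key : ∀ y, (MulAction.orbit (classStab hna a) y).Finite → y = a := fun y hy => by
      have : y ∈ acl G {a} := hy.subset (by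
        rintro _ ⟨g, rfl⟩
        exact ⟨⟨g.1, hsub g.2⟩, rfl⟩)
      rw [hna] at this
      simpa using this
    have hxa := finite_orbit_of_isFiniteRelIndex hfin hx
    obtain rfl := key x hxa
    intro b hb
    obtain ⟨g, rfl⟩ := MulAction.exists_smul_eq G x b
    refine key _ (hxa.subset ?_)
    rintro _ ⟨k, rfl⟩
    exact ⟨k * ⟨g, hb⟩, by simp [mul_smul]; rfl⟩

/-- G approximates σ on finite sets one point at a time: once g agrees with σ on D, inseparability
over σ(D) corrects the value at the next point. Closedness finishes. -/
theorem eq_top_of_forall_inseparable (hclosed : IsClosed (G : Set (Equiv.Perm ℕ)))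
    (h : ∀ a b, Inseparable G a b) : G = ⊤ := by
  classical
  refine eq_top_iff.2 fun σ _ => mem_of_forall_finset hclosed σ fun s => ?_
  induction s using Finset.induction_on with
  | empty => exact ⟨1, one_mem _, by simp⟩
  | insert x D hx ih =>
    obtain ⟨g, hg, hgD⟩ := ih
    have h1 : ∀ n ∈ D, n ≠ x := fun n hn h => hx (h ▸ hn)
    obtain ⟨k, hk, hkx⟩ := h (g x) (σ x) (D.image σ)
      (fun h' => by
        obtain ⟨n, hn, hne⟩ := Finset.mem_image.1 h'
        rw [← hgD n hn] at hne
        exact h1 n hn (g.injective hne))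
      (fun h' => by
        obtain ⟨n, hn, hne⟩ := Finset.mem_image.1 h'
        exact h1 n hn (σ.injective hne))
    refine ⟨k * g, mul_mem k.2 hg, fun n hn => ?_⟩
    rcases Finset.mem_insert.1 hn with rfl | hn
    · exact hkx
    · rw [Equiv.Perm.mul_apply, hgD n hn]
      exact mem_ptStab.1 hk _ (Finset.mem_image_of_mem _ hn)

theorem exists_separating (hclosed : IsClosed (G : Set (Equiv.Perm ℕ))) (hproper : G ≠ ⊤)
    (htrans : MulAction.IsPretransitive G ℕ) (hna : NoAlgebraicity G)
    (hwei : WeakEliminationOfImaginaries G) {a b : ℕ} (hab : b ≠ a) :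
    ∃ D : Finset ℕ, a ∉ D ∧ b ∉ D ∧ ∀ g ∈ ptStab G D, g • a ≠ b := by
  by_contra! hcon
  have hI : Inseparable G a b := hcon
  rcases eq_or_forall_inseparable htrans hna hwei a with h | h
  · exact hab (h b hI)
  · exact hproper (eq_top_of_forall_inseparable hclosed fun x y => (h x).symm.trans hna (h y))

open scoped Pointwise in
/-- **Neumann's lemma**: a group without finite orbits moves any finite set off itself. -/
theorem exists_smul_notMem {Γ α : Type*} [Group Γ] [MulAction Γ α]
    (hinf : ∀ x : α, (MulAction.orbit Γ x).Infinite) (A : Finset α) :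
    ∃ h : Γ, ∀ a ∈ A, h • a ∉ A := by
  classical
  by_contra! hcon
  let s : Finset (α × α) := A ×ˢ A
  let g : α × α → Γ := fun p => if h : ∃ k : Γ, k • p.1 = p.2 then h.choose else 1
  -- If every h sends some point of A into A, finitely many cosets of point stabilizers cover Γ. By
  -- B. H. Neumann's covering lemma one stabilizer has finite index, so its point has a finite
  -- orbit.
  have hcov : ⋃ p ∈ s, g p • (MulAction.stabilizer Γ p.1 : Set Γ) = Set.univ := by
    refine Set.eq_univ_of_forall fun h => ?_
    obtain ⟨a, ha, hha⟩ := hcon h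
    have hex : ∃ k : Γ, k • a = h • a := ⟨h, rfl⟩
    refine Set.mem_iUnion₂.2 ⟨(a, h • a), Finset.mem_product.2 ⟨ha, hha⟩, ?_⟩
    have hg : g (a, h • a) • a = h • a := by
      simp only [g, dif_pos hex]
      exact hex.choose_spec
    rw [mem_leftCoset_iff, SetLike.mem_coe, MulAction.mem_stabilizer_iff, mul_smul]
    exact inv_smul_eq_iff.2 hg.symm
  obtain ⟨p, -, hp⟩ := Subgroup.exists_finiteIndex_of_leftCoset_cover hcov
  exact hinf p.1 (finite_orbit_of_finiteIndex_stabilizer hp)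

end Separation

/-! ### Analytic sets are measurable for the completion of a finite measure. -/

section Analytic

theorem isCompact_box (N : ℕ → ℕ) : IsCompact {x : ℕ → ℕ | ∀ i, x i ≤ N i} := by
  have : {x : ℕ → ℕ | ∀ i, x i ≤ N i} = Set.pi Set.univ fun i => Set.Iic (N i) := by
    ext x
    simp only [Set.mem_ofPred_eq, Set.mem_pi, Set.mem_univ, true_implies, Set.mem_Iic]
  rw [this]
  exact isCompact_univ_pi fun i => (Set.finite_Iic (N i)).isCompact

/-- If a compact box `∏ [0, N i]` of Baire space lies in an open set, then so does the set of
sequences satisfying only finitely many of the bounds. -/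
theorem exists_bounded_subset_of_isOpen (N : ℕ → ℕ) {U : Set (ℕ → ℕ)} (hU : IsOpen U)
    (h : {x : ℕ → ℕ | ∀ i, x i ≤ N i} ⊆ U) : ∃ k, {x : ℕ → ℕ | ∀ i < k, x i ≤ N i} ⊆ U := by
  have hcyl : ∀ x ∈ U, ∃ n, PiNat.cylinder x n ⊆ U := fun x hx => by
    obtain ⟨v, ⟨y, n, rfl⟩, hxv, hv⟩ :=
      (PiNat.isTopologicalBasis_cylinders fun _ => ℕ).isOpen_iff.1 hU x hx
    exact ⟨n, PiNat.mem_cylinder_iff_eq.1 hxv ▸ hv⟩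
  choose! n hn using hcyl
  obtain ⟨t, ht, hKt⟩ := (isCompact_box N).elim_nhds_subcover (fun x => PiNat.cylinder x (n x))
    fun x _ => (PiNat.isOpen_cylinder _ x (n x)).mem_nhds (PiNat.self_mem_cylinder x (n x))
  refine ⟨t.sup n, fun x hx => ?_⟩
  -- The value 0 meets every bound, so y lies in the box while agreeing with x on all coordinates
  -- tested by the finite cover.
  let y : ℕ → ℕ := fun i => if i < t.sup n then x i else 0
  have hy : y ∈ {x : ℕ → ℕ | ∀ i, x i ≤ N i} := fun i => by
    by_cases hi : i < t.sup n
    · simpa only [y, if_pos hi] using hx i hi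
    · simp only [y, if_neg hi, Nat.zero_le]
  obtain ⟨z, hz, hyz⟩ := Set.mem_iUnion₂.1 (hKt hy)
  refine hn z (h (ht z hz)) fun i hi => ?_
  rw [← hyz i hi]
  exact (if_pos (hi.trans_le (Finset.le_sup hz))).symm

/-- The bounds are chosen one coordinate at a time: as the bound on coordinate k grows, the images
increase to the previous image. Continuity along increasing unions needs no measurability of these
images. -/
theorem exists_bound_measure_image {X : Type*} [MeasurableSpace X] (μ : Measure X)
    [IsFiniteMeasure μ] (f : (ℕ → ℕ) → X) {c : ENNReal} (hc : c < μ (Set.range f)) :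
    ∃ N : ℕ → ℕ, ∀ k, c < μ (f '' {x | ∀ i < k, x i ≤ N i}) := by
  have step : ∀ (k : ℕ) (N : ℕ → ℕ), c < μ (f '' {x | ∀ i < k, x i ≤ N i}) →
      ∃ m, c < μ (f '' {x | ∀ i < k + 1, x i ≤ Function.update N k m i}) := by
    intro k N h
    have hmono : Monotone fun m => f '' {x | ∀ i < k + 1, x i ≤ Function.update N k m i} := by
      intro m m' hm
      refine Set.image_mono fun x hx i hi => (hx i hi).trans ?_
      by_cases hik : i = k
      · subst hik; simpa using hm
      · simp [hik]
    have hU : f '' {x | ∀ i < k, x i ≤ N i} =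
        ⋃ m, f '' {x | ∀ i < k + 1, x i ≤ Function.update N k m i} := by
      rw [← Set.image_iUnion]
      congr 1
      ext x
      simp only [Set.mem_ofPred_eq, Set.mem_iUnion]
      refine ⟨fun hx => ⟨x k, fun i hi => ?_⟩, fun ⟨m, hx⟩ i hi => ?_⟩
      · rcases Nat.lt_succ_iff_lt_or_eq.1 hi with hi | rfl
        · simpa [hi.ne] using hx i hi
        · simp
      · simpa [hi.ne] using hx i (hi.trans k.lt_succ_self)
    rw [hU, hmono.measure_iUnion] at h
    exact lt_iSup_iff.1 h
  choose! m hm using step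
  let S : ℕ → ℕ → ℕ := fun k => Nat.rec (fun _ => 0) (fun k N => Function.update N k (m k N)) k
  have hS : ∀ k, S (k + 1) = Function.update (S k) k (m k (S k)) := fun _ => rfl
  have hc' : ∀ k, c < μ (f '' {x | ∀ i < k, x i ≤ S k i}) := by
    intro k
    induction k with
    | zero => simpa using hc
    | succ k ih => rw [hS]; exact hm k _ ih
  have hstab : ∀ i k, i < k → S k i = S (i + 1) i := by
    intro i k hik
    induction k, hik using Nat.le_induction with
    | base => rfl
    | succ k hk ih => rw [hS, Function.update_of_ne (by omega), ih]
  refine ⟨fun i => S (i + 1) i, fun k => ?_⟩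
  convert hc' k using 8 with x i hi
  rw [hstab i k hi]

/-- Inner approximation: the closures of the images cut out by the first k bounds decrease, by
compactness, into the image of the full box, while each retains measure above c. -/
theorem nullMeasurableSet_of_analyticSet {X : Type*} [TopologicalSpace X] [T3Space X]
    [MeasurableSpace X] [BorelSpace X] (μ : Measure X) [IsFiniteMeasure μ] {s : Set X}
    (hs : AnalyticSet s) : NullMeasurableSet s μ := by
  rw [AnalyticSet] at hs
  rcases hs with rfl | ⟨f, hf, rfl⟩
  · exact .empty
  have key : ∀ c < μ (Set.range f), ∃ K, MeasurableSet K ∧ K ⊆ Set.range f ∧ c ≤ μ K := by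
    intro c hc
    obtain ⟨N, hN⟩ := exists_bound_measure_image μ f hc
    let C : ℕ → Set X := fun k => closure (f '' {x | ∀ i < k, x i ≤ N i})
    have hanti : Antitone C := fun k l hkl =>
      closure_mono (Set.image_mono fun x hx i hi => hx i (hi.trans_le hkl))
    refine ⟨⋂ k, C k, .iInter fun k => isClosed_closure.measurableSet, fun y hy => ?_, ?_⟩
    · by_contra hyn
      have hyK : y ∉ f '' {x : ℕ → ℕ | ∀ i, x i ≤ N i} := fun h => hyn (Set.image_subset_range _ _ h)
      obtain ⟨U, V, hU, hV, hKU, hyV, hUV⟩ :=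
        SeparatedNhds.of_isCompact_isCompact ((isCompact_box N).image hf) isCompact_singleton
          (Set.disjoint_singleton_right.2 hyK)
      obtain ⟨k, hk⟩ := exists_bounded_subset_of_isOpen N (hU.preimage hf)
        (Set.image_subset_iff.1 hKU)
      have h1 : closure (f '' {x | ∀ i < k, x i ≤ N i}) ⊆ Vᶜ :=
        closure_minimal ((Set.image_subset_iff.2 hk).trans hUV.subset_compl_right) hV.isClosed_compl
      exact h1 (Set.mem_iInter.1 hy k) (hyV rfl)
    · rw [hanti.measure_iInter (fun k => isClosed_closure.measurableSet.nullMeasurableSet)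
        ⟨0, measure_ne_top _ _⟩]
      exact le_iInf fun k => (hN k).le.trans (measure_mono subset_closure)
  rcases eq_or_ne (μ (Set.range f)) 0 with h0 | h0
  · exact .of_null h0
  obtain ⟨u, -, hu, hlim⟩ := exists_seq_strictMono_tendsto' (bot_lt_iff_ne_bot.2 h0)
  choose K hKm hKs hKc using fun n => key (u n) (hu n).2
  have hsub : ⋃ n, K n ⊆ Set.range f := Set.iUnion_subset hKs
  have hle : μ (Set.range f) ≤ μ (⋃ n, K n) :=
    le_of_tendsto' hlim fun n => (hKc n).trans (measure_mono (Set.subset_iUnion K n))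
  exact (MeasurableSet.iUnion hKm).nullMeasurableSet.congr
    (ae_eq_of_subset_of_measure_ge hsub hle (MeasurableSet.iUnion hKm).nullMeasurableSet
      (measure_ne_top _ _))

end Analytic

/-! ### Events defined by stabilizers, and independence over disjoint sets. -/

section Invariants

variable (G : Subgroup (Equiv.Perm ℕ)) {X : Type} [MulAction G X]

/-- The set `S` is null measurable and invariant up to null sets under `G_A`. -/
def AEInv [MeasurableSpace X] (μ : Measure X) (A : Finset ℕ) (S : Set X) : Prop :=
  NullMeasurableSet S μ ∧ ∀ g ∈ ptStab G A, (fun x => g • x) ⁻¹' S =ᵐ[μ] S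

/-- The points whose stabilizer sends `a` to `b`. -/
def moveSet (X : Type) [MulAction G X] (a b : ℕ) : Set X :=
  {x | ∃ h ∈ MulAction.stabilizer G x, h • a = b}

/-- The points whose stabilizer fixes every element of `D`. -/
def fixSet (X : Type) [MulAction G X] (D : Finset ℕ) : Set X :=
  {x | ∀ h ∈ MulAction.stabilizer G x, ∀ d ∈ D, h • d = d}

/-- The points under whose stabilizer `a` has a finite orbit. -/
def finiteOrbitSet (X : Type) [MulAction G X] (a : ℕ) : Set X :=
  {x | {b | x ∈ moveSet G X a b}.Finite}

variable {G}

theorem preimage_smul_moveSet (g : G) (a b : ℕ) :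
    (fun x => g • x) ⁻¹' moveSet G X (g • a) (g • b) = moveSet G X a b := by
  ext x
  simp only [Set.mem_preimage, moveSet, Set.mem_ofPred_eq, MulAction.mem_stabilizer_iff]
  refine ⟨fun ⟨h, hx, hab⟩ => ⟨g⁻¹ * h * g, ?_, ?_⟩, fun ⟨h, hx, hab⟩ => ⟨g * h * g⁻¹, ?_, ?_⟩⟩
  · rw [mul_smul, mul_smul, hx, inv_smul_smul]
  · rw [mul_smul, mul_smul, hab, inv_smul_smul]
  · rw [mul_smul, mul_smul, inv_smul_smul, hx]
  · rw [mul_smul, mul_smul, inv_smul_smul, hab]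

theorem preimage_smul_fixSet (g : G) (D : Finset ℕ) :
    (fun x => g • x) ⁻¹' fixSet G X (D.image fun n => g • n) = fixSet G X D := by
  ext x
  simp only [Set.mem_preimage, fixSet, Set.mem_ofPred_eq, MulAction.mem_stabilizer_iff,
    Finset.forall_mem_image]
  refine ⟨fun H h hx d hd => ?_, fun H h hx d hd => ?_⟩
  · have := H (g * h * g⁻¹) (by rw [mul_smul, mul_smul, inv_smul_smul, hx]) hd
    rw [mul_smul, mul_smul, inv_smul_smul] at this
    exact smul_left_cancel g this
  · have := H (g⁻¹ * h * g) (by rw [mul_smul, mul_smul, hx, inv_smul_smul]) d hd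
    rwa [mul_smul, mul_smul, inv_smul_eq_iff] at this

theorem preimage_smul_finiteOrbitSet (g : G) (a : ℕ) :
    (fun x => g • x) ⁻¹' finiteOrbitSet G X (g • a) = finiteOrbitSet G X a := by
  ext x
  have h1 : {b | g • x ∈ moveSet G X (g • a) b} =
      (MulAction.toPerm g : Equiv.Perm ℕ) '' {b | x ∈ moveSet G X a b} := by
    ext b
    rw [Equiv.image_eq_preimage_symm]
    change _ ↔ x ∈ moveSet G X a (g⁻¹ • b)
    rw [← preimage_smul_moveSet g, smul_inv_smul]
    rfl
  change {b | g • x ∈ moveSet G X (g • a) b}.Finite ↔ {b | x ∈ moveSet G X a b}.Finite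
  rw [h1, Set.finite_image_iff (Equiv.injective _).injOn]

theorem orbit_stabilizer_eq (x : X) (a : ℕ) :
    MulAction.orbit (MulAction.stabilizer G x) a = {b | x ∈ moveSet G X a b} := by
  ext b
  constructor
  · rintro ⟨h, rfl⟩
    exact ⟨h, h.2, rfl⟩
  · rintro ⟨h, hx, rfl⟩
    exact ⟨⟨h, hx⟩, rfl⟩

/-- Expresses the event by countably many move sets, so that null measurability passes to it. -/
theorem fixSet_eq_iInter (D : Finset ℕ) :
    fixSet G X D = ⋂ d ∈ D, ⋂ b ∈ {b | b ≠ d}, (moveSet G X d b)ᶜ := by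
  ext x
  simp only [fixSet, moveSet, Set.mem_ofPred_eq, Set.mem_iInter, Set.mem_compl_iff, not_exists,
    not_and]
  exact ⟨fun H d hd b hb h hx hdb => hb (by rw [← hdb, H h hx d hd]),
    fun H h hx d hd => by_contra fun hne => H d hd (h • d) hne h hx rfl⟩

theorem finiteOrbitSet_eq_iUnion (a : ℕ) :
    finiteOrbitSet G X a = ⋃ B : Finset ℕ, ⋂ b ∈ {b | b ∉ B}, (moveSet G X a b)ᶜ := by
  ext x
  simp only [finiteOrbitSet, Set.mem_ofPred_eq, Set.mem_iUnion, Set.mem_iInter, Set.mem_compl_iff]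
  exact ⟨fun h => ⟨h.toFinset, fun b hb hx => hb (h.mem_toFinset.2 hx)⟩,
    fun ⟨B, hB⟩ => B.finite_toSet.subset fun b hb => by_contra fun h => hB b h hb⟩

variable [MeasurableSpace X] {μ : Measure X}

theorem AEInv.compl {A : Finset ℕ} {S : Set X} (hS : AEInv G μ A S) : AEInv G μ A Sᶜ :=
  ⟨hS.1.compl, fun g hg => (hS.2 g hg).compl⟩

theorem aeInv_of_preimage_eq {A : Finset ℕ} {S : Set X} (hS : NullMeasurableSet S μ)
    (h : ∀ g ∈ ptStab G A, (fun x => g • x) ⁻¹' S = S) : AEInv G μ A S :=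
  ⟨hS, fun g hg => (h g hg).eventuallyEq⟩

variable [MeasurableSMul₂ G X] [ErgodicSMul G X μ]

/-- The independence hypothesis concerns genuinely measurable sets, whereas the stabilizer events
are only null measurable. -/
theorem AEInv.exists_measurableSet {A : Finset ℕ} {S : Set X} (hS : AEInv G μ A S) :
    ∃ T, MeasurableSet[invSigma G μ A] T ∧ T =ᵐ[μ] S := by
  obtain ⟨T, -, hT, hTS⟩ := hS.1.exists_measurable_superset_ae_eq
  refine ⟨T, ⟨hT, fun g hg => ?_⟩, hTS⟩
  exact (((measurePreserving_smul g μ).quasiMeasurePreserving.preimage_ae_eq hTS).trans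
    (hS.2 g hg)).trans hTS.symm

variable [StandardBorelSpace X] [IsProbabilityMeasure μ]

/-- Invariant sets over disjoint finite sets are independent. -/
theorem measure_inter_of_disjoint (hG : DynamicallyDeFinetti G) {A B : Finset ℕ}
    (hAB : Disjoint A B) {S T : Set X} (hS : AEInv G μ A S) (hT : AEInv G μ B T) :
    μ (S ∩ T) = μ S * μ T := by
  obtain ⟨S', hS', hSS⟩ := hS.exists_measurableSet
  obtain ⟨T', hT', hTT⟩ := hT.exists_measurableSet
  rw [← measure_congr hSS, ← measure_congr hTT, ← measure_congr (hSS.inter hTT)]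
  have hci := hG.condIndep X μ A B
  rw [ProbabilityTheory.condIndep_iff _ _ _ _ (invSigma_le G μ A) (invSigma_le G μ B)] at hci
  have h := hci S' T' hS' hT'
  -- Here A ∩ B is empty and G_∅ = G, so by ergodicity conditional probabilities over 𝓕_∅ are
  -- constants.
  have hconst : ∀ U : Set X, MeasurableSet U →
      μ[U.indicator fun _ => (1 : ℝ) | invSigma G μ (A ∩ B)] =ᵐ[μ] fun _ => μ.real U := by
    intro U hU
    refine (ae_eq_condExp_of_forall_setIntegral_eq (invSigma_le G μ (A ∩ B))
      ((integrable_const _).indicator hU) (fun _ _ _ => integrableOn_const)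
      (fun s hs _ => ?_) aestronglyMeasurable_const).symm
    rw [Finset.disjoint_iff_inter_eq_empty.1 hAB] at hs
    have hc := aeconst_of_forall_preimage_smul_ae_eq G (μ := μ) hs.1.nullMeasurableSet
      fun g => hs.2 g (mem_ptStab.2 (by simp))
    rw [setIntegral_const, integral_indicator hU, setIntegral_const, smul_eq_mul, smul_eq_mul,
      mul_one, measureReal_restrict_apply hU]
    rcases Filter.eventuallyConst_set'.1 hc with h0 | h1
    · rw [measureReal_congr h0, measureReal_congr ((ae_eq_refl U).inter h0)]
      simp
    · rw [measureReal_congr h1, measureReal_congr ((ae_eq_refl U).inter h1)]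
      simp
  have h' := ((hconst _ (hS'.1.inter hT'.1)).symm.trans h).trans
    ((hconst _ hS'.1).mul (hconst _ hT'.1))
  obtain ⟨x, hx⟩ := h'.exists
  have hx' : μ.real (S' ∩ T') = μ.real S' * μ.real T' := hx
  rw [measureReal_def, measureReal_def, measureReal_def, ← ENNReal.toReal_mul] at hx'
  exact (ENNReal.toReal_eq_toReal_iff' (measure_ne_top _ _)
    (ENNReal.mul_ne_top (measure_ne_top _ _) (measure_ne_top _ _))).1 hx'

end Invariants

/-! ### Dichotomy for stabilizers: trivial, or without finite orbits. -/

section FixedPoints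

variable {G : Subgroup (Equiv.Perm ℕ)} {X : Type} [MulAction G X] [MeasurableSpace X]
  {μ : Measure X}

theorem nullMeasurableSet_fixSet (hE : ∀ a b, NullMeasurableSet (moveSet G X a b) μ)
    (D : Finset ℕ) : NullMeasurableSet (fixSet G X D) μ := by
  rw [fixSet_eq_iInter]
  exact .biInter D.countable_toSet fun d _ => .biInter (Set.to_countable _) fun b _ => (hE d b).compl

theorem nullMeasurableSet_finiteOrbitSet (hE : ∀ a b, NullMeasurableSet (moveSet G X a b) μ)
    (a : ℕ) : NullMeasurableSet (finiteOrbitSet G X a) μ := by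
  rw [finiteOrbitSet_eq_iUnion]
  exact .iUnion fun B => .biInter (Set.to_countable _) fun b _ => (hE a b).compl

theorem aeInv_fixSet (hE : ∀ a b, NullMeasurableSet (moveSet G X a b) μ) (D : Finset ℕ) :
    AEInv G μ D (fixSet G X D) :=
  aeInv_of_preimage_eq (nullMeasurableSet_fixSet hE D) fun g hg => by
    conv_rhs => rw [← preimage_smul_fixSet g D]
    congr 2
    ext n
    rw [Finset.mem_image]
    refine ⟨fun hn => ⟨n, hn, mem_ptStab.1 hg n hn⟩, ?_⟩
    rintro ⟨m, hm, rfl⟩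
    rwa [mem_ptStab.1 hg m hm]

variable [IsProbabilityMeasure μ] [ErgodicSMul G X μ]

/-- Finite orbits of the stabilizers are almost surely trivial. -/
theorem measure_moveSet_inter_finiteOrbitSet (hna : NoAlgebraicity G)
    (hE : ∀ a b, NullMeasurableSet (moveSet G X a b) μ) {a b : ℕ} (hab : b ≠ a) :
    μ (moveSet G X a b ∩ finiteOrbitSet G X a) = 0 := by
  have hinf := infinite_orbit_of_notMem hna (A := {a}) (x := b) (by simpa using hab)
  -- The points β i are G_a-translates of b, so all events T i have the same probability. No x lies
  -- in infinitely many of them, as its stabilizer would give a an infinite orbit; so that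
  -- probability is 0.
  let β := hinf.natEmbedding
  let T : ℕ → Set X := fun i => moveSet G X a (β i) ∩ finiteOrbitSet G X a
  have hT : ∀ i, μ (T i) = μ (moveSet G X a b ∩ finiteOrbitSet G X a) := by
    intro i
    obtain ⟨k, hk⟩ := (β i).2
    have hka : (k : G) • a = a := mem_ptStab.1 k.2 a (by simp)
    have hkb : (k : G) • b = β i := hk
    have hpre : (fun x => (k : G) • x) ⁻¹' T i = moveSet G X a b ∩ finiteOrbitSet G X a := by
      have h1 := preimage_smul_moveSet (X := X) (k : G) a b
      have h2 := preimage_smul_finiteOrbitSet (X := X) (k : G) a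
      rw [hka, hkb] at h1
      rw [hka] at h2
      rw [Set.preimage_inter, h1, h2]
    rw [← hpre, measure_preimage_smul]
  have hTm : ∀ i, NullMeasurableSet (T i) μ := fun i =>
    (hE a _).inter (nullMeasurableSet_finiteOrbitSet hE a)
  have hanti : Antitone fun n => ⋃ i ≥ n, T i := fun m n hmn =>
    Set.biUnion_mono (fun i hi => le_trans hmn hi) fun _ _ => le_rfl
  have hempty : ⋂ n, ⋃ i ≥ n, T i = ∅ := by
    refine Set.eq_empty_of_forall_notMem fun x hx => ?_
    rw [Set.mem_iInter] at hx
    have hfin : {b | x ∈ moveSet G X a b}.Finite := by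
      obtain ⟨i, -, hi⟩ := Set.mem_iUnion₂.1 (hx 0)
      exact hi.2
    have hfin' : {i | x ∈ moveSet G X a (β i)}.Finite :=
      Set.Finite.preimage (f := fun i => (β i : ℕ)) (Subtype.val_injective.comp β.injective).injOn hfin
    obtain ⟨n, hn⟩ := hfin'.bddAbove
    obtain ⟨i, hi, hxi⟩ := Set.mem_iUnion₂.1 (hx (n + 1))
    exact absurd (hn (show i ∈ {i | x ∈ moveSet G X a (β i)} from hxi.1)) (by omega)
  have h := hanti.measure_iInter (μ := μ)
    (fun n => .biUnion (Set.to_countable _) fun i _ => hTm i) ⟨0, measure_ne_top _ _⟩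
  rw [hempty, measure_empty] at h
  refine le_antisymm ?_ zero_le
  rw [h]
  exact le_iInf fun n => (hT n).symm.le.trans
    (measure_mono (Set.subset_biUnion_of_mem (u := T) (le_refl n)))

theorem ae_fixed_of_finite_orbit (hna : NoAlgebraicity G)
    (hE : ∀ a b, NullMeasurableSet (moveSet G X a b) μ) :
    ∀ᵐ x ∂μ, ∀ a : ℕ, (MulAction.orbit (MulAction.stabilizer G x) a).Finite → x ∈ fixSet G X {a} := by
  have h : ∀ᵐ x ∂μ, ∀ a b, b ≠ a → x ∉ moveSet G X a b ∩ finiteOrbitSet G X a := by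
    refine ae_all_iff.2 fun a => ae_all_iff.2 fun b => ?_
    by_cases hab : b = a
    · simp [hab]
    · filter_upwards [measure_eq_zero_iff_ae_notMem.1
        (measure_moveSet_inter_finiteOrbitSet hna hE hab)] with x hx _ using hx
  filter_upwards [h] with x hx a ha g hg d hd
  obtain rfl := Finset.mem_singleton.1 hd
  rw [orbit_stabilizer_eq] at ha
  exact by_contra fun hne => hx d (g • d) hne ⟨⟨g, hg, rfl⟩, ha⟩

variable [StandardBorelSpace X] [MeasurableSMul₂ G X]

/-- Fixing a and fixing D are independent events when a ∉ D, so their probabilities multiply. -/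
theorem measure_fixSet_ne_zero (hG : DynamicallyDeFinetti G)
    (hE : ∀ a b, NullMeasurableSet (moveSet G X a b) μ) (h : ∀ a, μ (fixSet G X {a}) ≠ 0)
    (D : Finset ℕ) : μ (fixSet G X D) ≠ 0 := by
  classical
  induction D using Finset.induction_on with
  | empty => simp [fixSet]
  | insert a D ha ih =>
    have : fixSet G X (insert a D) = fixSet G X {a} ∩ fixSet G X D := by
      ext x
      simp only [fixSet, Finset.mem_insert, forall_eq_or_imp, Finset.mem_singleton, forall_eq,
        Set.mem_ofPred_eq, Set.mem_inter_iff]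
      exact ⟨fun H => ⟨fun g hg => (H g hg).1, fun g hg => (H g hg).2⟩,
        fun H g hg => ⟨H.1 g hg, H.2 g hg⟩⟩
    rw [this, measure_inter_of_disjoint hG (Finset.disjoint_singleton_left.2 ha)
      (aeInv_fixSet hE _) (aeInv_fixSet hE _)]
    exact mul_ne_zero (h a) ih

/-- If a point is fixed by the stabilizers with positive probability, then two given points are
almost surely not moved to each other. -/
theorem measure_moveSet_eq_zero (hG : DynamicallyDeFinetti G)
    (hE : ∀ a b, NullMeasurableSet (moveSet G X a b) μ) (h : ∀ a, μ (fixSet G X {a}) ≠ 0)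
    {a b : ℕ} {D : Finset ℕ} (ha : a ∉ D) (hb : b ∉ D) (hD : ∀ g ∈ ptStab G D, g • a ≠ b) :
    μ (moveSet G X a b) = 0 := by
  classical
  -- Taking all translates of D makes the event invariant over {a, b}, which is disjoint from D; its
  -- complement is then independent of the positive event of fixing D, yet disjoint from it.
  let U : Set X := ⋃ D' ∈ {D' | ∃ k ∈ ptStab G {a, b}, D' = D.image fun n => k • n}, fixSet G X D'
  have hU : AEInv G μ {a, b} U := by
    refine aeInv_of_preimage_eq
      (.biUnion (Set.to_countable _) fun D' _ => nullMeasurableSet_fixSet hE D') fun g hg => ?_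
    have hsub : ∀ g ∈ ptStab G {a, b}, U ⊆ (fun x => g • x) ⁻¹' U := by
      intro g hg x hx
      obtain ⟨D', ⟨k, hk, rfl⟩, hx⟩ := Set.mem_iUnion₂.1 hx
      refine Set.mem_iUnion₂.2 ⟨_, ⟨g * k, mul_mem hg hk, rfl⟩, ?_⟩
      rw [← preimage_smul_fixSet g] at hx
      simpa [Finset.image_image, Function.comp_def, mul_smul] using hx
    refine (hsub g hg).antisymm' fun x hx => ?_
    have := hsub g⁻¹ (inv_mem hg) hx
    simpa using this
  have hUc : μ Uᶜ = 0 := by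
    have h0 : Uᶜ ∩ fixSet G X D = ∅ := by
      refine Set.eq_empty_of_forall_notMem fun x hx => hx.1 ?_
      exact Set.mem_iUnion₂.2 ⟨D, ⟨1, one_mem _, by simp⟩, hx.2⟩
    have := measure_inter_of_disjoint hG (A := {a, b}) (B := D) (by simp [ha, hb]) hU.compl
      (aeInv_fixSet hE D)
    rw [h0, measure_empty] at this
    exact (mul_eq_zero.1 this.symm).resolve_right (measure_fixSet_ne_zero hG hE h D)
  refine measure_mono_null ?_ hUc
  rintro x ⟨g, hg, hgab⟩ hx
  obtain ⟨D', ⟨k, hk, rfl⟩, hx⟩ := Set.mem_iUnion₂.1 hx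
  have hka : k • a = a := mem_ptStab.1 hk a (by simp)
  have hkb : k • b = b := mem_ptStab.1 hk b (by simp)
  -- As k fixes a and b, conjugating g back by k gives an element fixing D and still sending a to b.
  refine hD (k⁻¹ * g * k) (mem_ptStab.2 fun n hn => ?_) ?_
  · rw [mul_smul, mul_smul, hx g hg _ (Finset.mem_image_of_mem _ hn), inv_smul_smul]
  · rw [mul_smul, mul_smul, hka, hgab, inv_smul_eq_iff, hkb]

/-- The stabilizers of an ergodic action of a dynamically de Finetti group are almost surely
trivial, or almost surely without finite orbits. -/
theorem ae_stabilizer_eq_bot_or_infinite_orbit (hclosed : IsClosed (G : Set (Equiv.Perm ℕ)))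
    (hproper : G ≠ ⊤) (htrans : MulAction.IsPretransitive G ℕ) (hG : DynamicallyDeFinetti G)
    (hE : ∀ a b, NullMeasurableSet (moveSet G X a b) μ) :
    (∀ᵐ x ∂μ, MulAction.stabilizer G x = ⊥) ∨
      ∀ᵐ x ∂μ, ∀ a : ℕ, (MulAction.orbit (MulAction.stabilizer G x) a).Infinite := by
  by_cases h : ∃ a, μ (fixSet G X {a}) ≠ 0
  · left
    obtain ⟨a, ha⟩ := h
    have hall : ∀ c, μ (fixSet G X {c}) ≠ 0 := fun c => by
      obtain ⟨g, rfl⟩ := MulAction.exists_smul_eq G a c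
      rwa [← preimage_smul_fixSet g, measure_preimage_smul, Finset.image_singleton] at ha
    have hmove : ∀ᵐ x ∂μ, ∀ a b, b ≠ a → x ∉ moveSet G X a b := by
      refine ae_all_iff.2 fun a => ae_all_iff.2 fun b => ?_
      by_cases hab : b = a
      · simp [hab]
      · obtain ⟨D, haD, hbD, hD⟩ :=
          exists_separating hclosed hproper htrans hG.noAlgebraicity hG.weakElimination hab
        filter_upwards [measure_eq_zero_iff_ae_notMem.1
          (measure_moveSet_eq_zero hG hE hall haD hbD hD)] with x hx _ using hx
    filter_upwards [hmove] with x hx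
    refine (Subgroup.eq_bot_iff_forall _).2 fun g hg => Subtype.ext (Equiv.ext fun n => ?_)
    exact by_contra fun hne => hx n (g • n) hne ⟨g, hg, rfl⟩
  · right
    push Not at h
    filter_upwards [ae_fixed_of_finite_orbit hG.noAlgebraicity hE,
      ae_all_iff.2 fun a => measure_eq_zero_iff_ae_notMem.1 (h a)] with x hx hx' a hfin
    exact hx' a (hx a hfin)

end FixedPoints

/-! ### Types over a finite set: cells of countable families of invariant sets. -/

section Cells

/-- In a countably generated probability space every family of measurable sets has a countable
subfamily that is dense for the measure of the symmetric difference. -/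
theorem exists_countable_dense_subfamily {X : Type*} [MeasurableSpace X]
    [MeasurableSpace.CountablyGenerated X] (μ : Measure X) [IsFiniteMeasure μ] (𝒮 : Set (Set X))
    (h𝒮 : ∀ S ∈ 𝒮, MeasurableSet S) :
    ∃ t ⊆ 𝒮, t.Countable ∧ ∀ Z ∈ 𝒮, ∀ ε : ℝ, 0 < ε →
      ∃ S ∈ t, μ (symmDiff Z S) < ENNReal.ofReal ε := by
  obtain ⟨𝒜, h𝒜c, h𝒜⟩ := exists_countable_measureDense μ
  -- The members of 𝒜 need not lie in 𝒮; for each one and each precision 1/(n+1), one nearby member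
  -- of 𝒮 is kept when there is any.
  let I : Set (Set X × ℕ) := {p | p.1 ∈ 𝒜 ∧
    ∃ S ∈ 𝒮, μ (symmDiff S p.1) < ENNReal.ofReal (1 / (p.2 + 1))}
  have hIc : I.Countable := by
    refine (h𝒜c.prod (Set.countable_univ (α := ℕ))).mono fun p hp => ?_
    exact Set.mem_prod.2 ⟨hp.1, Set.mem_univ _⟩
  have hI : ∀ p ∈ I, ∃ S ∈ 𝒮, μ (symmDiff S p.1) < ENNReal.ofReal (1 / (p.2 + 1)) := fun p hp => hp.2
  choose! F hF𝒮 hF using hI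
  refine ⟨F '' I, Set.image_subset_iff.2 hF𝒮, hIc.image F, fun Z hZ ε hε => ?_⟩
  obtain ⟨n, hn⟩ := exists_nat_one_div_lt (half_pos hε)
  obtain ⟨A, hA, hZA⟩ := h𝒜.approx Z (h𝒮 Z hZ) (measure_ne_top _ _) (1 / (n + 1)) (by positivity)
  have hp : (A, n) ∈ I := ⟨hA, Z, hZ, hZA⟩
  refine ⟨F (A, n), ⟨_, hp, rfl⟩, ?_⟩
  calc μ (symmDiff Z (F (A, n)))
      ≤ μ (symmDiff Z A) + μ (symmDiff A (F (A, n))) :=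
        (measure_mono (symmDiff_triangle _ _ _)).trans (measure_union_le _ _)
    _ < ENNReal.ofReal (1 / (n + 1)) + ENNReal.ofReal (1 / (n + 1)) := by
        refine ENNReal.add_lt_add hZA ?_
        rw [symmDiff_comm]
        exact hF _ hp
    _ = ENNReal.ofReal (1 / (n + 1) + 1 / (n + 1)) :=
        (ENNReal.ofReal_add (by positivity) (by positivity)).symm
    _ ≤ ENNReal.ofReal ε := ENNReal.ofReal_le_ofReal (by linarith)

variable {X : Type}

/-- The points that belong to the same members of the family `t` as `x`. -/
def cell (t : Set (Set X)) (x : X) : Set X := {y | ∀ S ∈ t, (y ∈ S ↔ x ∈ S)}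

theorem mem_cell_self (t : Set (Set X)) (x : X) : x ∈ cell t x := fun _ _ => Iff.rfl

theorem mem_cell_comm {t : Set (Set X)} {x y : X} : x ∈ cell t y ↔ y ∈ cell t x :=
  forall₂_congr fun _ _ => Iff.comm

theorem cell_eq_of_mem {t : Set (Set X)} {x y : X} (h : y ∈ cell t x) : cell t y = cell t x := by
  ext z
  exact forall₂_congr fun _ hS => by rw [h _ hS]

theorem cell_union (t u : Set (Set X)) (x : X) : cell (t ∪ u) x = cell t x ∩ cell u x := by
  ext y
  simp [cell, or_imp, forall_and]

theorem cell_mono {t u : Set (Set X)} (h : t ⊆ u) (x : X) : cell u x ⊆ cell t x :=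
  fun _ hy S hS => hy S (h hS)

/-- The indicator function of the members of `t`. -/
def cellMap (t : Set (Set X)) (x : X) : t → Prop := fun S => x ∈ (S : Set X)

theorem cell_eq_preimage (t : Set (Set X)) (x : X) : cell t x = cellMap t ⁻¹' {cellMap t x} := by
  ext y
  simp only [cell, cellMap, Set.mem_preimage, Set.mem_singleton_iff, funext_iff, eq_iff_iff,
    Subtype.forall, Set.mem_ofPred_eq]

theorem measurable_cellMap [MeasurableSpace X] {t : Set (Set X)}
    (ht : ∀ S ∈ t, MeasurableSet S) : Measurable (cellMap t) :=
  measurable_pi_lambda _ fun S => measurableSet_setOfPred.1 (ht S S.2)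

theorem measurableSet_cell [MeasurableSpace X] {t : Set (Set X)} (htc : t.Countable)
    (ht : ∀ S ∈ t, MeasurableSet S) (x : X) : MeasurableSet (cell t x) := by
  have := htc.to_subtype
  rw [cell_eq_preimage]
  exact measurable_cellMap ht (measurableSet_singleton _)

variable (G : Subgroup (Equiv.Perm ℕ)) [MulAction G X] [MeasurableSpace X]

/-- The measurable sets that are strictly invariant under `G_A`. -/
def strictInv (X : Type) [MulAction G X] [MeasurableSpace X] (A : Finset ℕ) : Set (Set X) :=
  {S | MeasurableSet S ∧ ∀ g ∈ ptStab G A, ∀ x, g • x ∈ S ↔ x ∈ S}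

variable {G}

theorem strictInv_mono {A B : Finset ℕ} (h : A ⊆ B) : strictInv G X A ⊆ strictInv G X B :=
  fun _ hS => ⟨hS.1, fun g hg => hS.2 g (ptStab_anti h hg)⟩

theorem cellMap_smul {A : Finset ℕ} {t : Set (Set X)} (ht : t ⊆ strictInv G X A) {g : G}
    (hg : g ∈ ptStab G A) (x : X) : cellMap t (g • x) = cellMap t x :=
  funext fun S => propext ((ht S.2).2 g hg x)

theorem cell_smul {A : Finset ℕ} {t : Set (Set X)} (ht : t ⊆ strictInv G X A) {g : G}
    (hg : g ∈ ptStab G A) (x : X) : cell t (g • x) = cell t x := by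
  rw [cell_eq_preimage, cell_eq_preimage, cellMap_smul ht hg]

theorem smul_mem_cell {A : Finset ℕ} {t : Set (Set X)} (ht : t ⊆ strictInv G X A) {g : G}
    (hg : g ∈ ptStab G A) {x y : X} : g • y ∈ cell t x ↔ y ∈ cell t x := by
  rw [mem_cell_comm, cell_smul ht hg, mem_cell_comm]

theorem cell_mem_strictInv {A : Finset ℕ} {t : Set (Set X)} (htc : t.Countable)
    (ht : t ⊆ strictInv G X A) (x : X) : cell t x ∈ strictInv G X A :=
  ⟨measurableSet_cell htc (fun _ hS => (ht hS).1) x, fun _ hg _ => smul_mem_cell ht hg⟩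

/-- A coset is determined by the images of the points of A. This is what reduces quantifiers over
the uncountable group G to countably many representatives. -/
instance countable_quotient_ptStab (A : Finset ℕ) : Countable (G ⧸ ptStab G A) := by
  let f : G ⧸ ptStab G A → (A → ℕ) := fun q n => q.out • (n : ℕ)
  refine Function.Injective.countable (f := f) fun p q hpq => ?_
  rw [← Quotient.out_eq' p, ← Quotient.out_eq' q]
  refine QuotientGroup.eq.2 (mem_ptStab.2 fun n hn => ?_)
  have : q.out • n = p.out • n := (congrFun hpq ⟨n, hn⟩).symm
  rw [mul_smul, this, inv_smul_smul]

/-- Every element of `G` is a representative of a coset of `G_A` times an element of `G_A`. -/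
theorem exists_eq_out_mul (A : Finset ℕ) (g : G) :
    ∃ q : G ⧸ ptStab G A, ∃ k ∈ ptStab G A, g = q.out * k := by
  obtain ⟨k, hk⟩ := QuotientGroup.mk_out_eq_mul (ptStab G A) g
  exact ⟨g, k⁻¹, inv_mem k.2, by rw [hk, mul_inv_cancel_right]⟩

theorem exists_eq_mul_out_inv (A : Finset ℕ) (g : G) :
    ∃ q : G ⧸ ptStab G A, ∃ k ∈ ptStab G A, g = k * q.out⁻¹ := by
  obtain ⟨q, k, hk, h⟩ := exists_eq_out_mul A g⁻¹
  exact ⟨q, k⁻¹, inv_mem hk, by rw [← inv_inv g, h, mul_inv_rev]⟩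

/-- Since S is G_B-invariant, its G_A-saturation is a union of countably many translates, indexed by
cosets of G_B. -/
theorem strictInv_orbit_mem [MeasurableConstSMul G X] {A B : Finset ℕ} (hAB : A ⊆ B) {S : Set X}
    (hS : S ∈ strictInv G X B) : {x | ∃ k ∈ ptStab G A, k • x ∈ S} ∈ strictInv G X A := by
  refine ⟨?_, fun g hg x => ⟨fun ⟨k, hk, h⟩ => ⟨k * g, mul_mem hk hg, by rwa [mul_smul]⟩,
    fun ⟨k, hk, h⟩ => ⟨k * g⁻¹, mul_mem hk (inv_mem hg), by rwa [mul_smul, inv_smul_smul]⟩⟩⟩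
  have : {x | ∃ k ∈ ptStab G A, k • x ∈ S} =
      ⋃ q ∈ {q : G ⧸ ptStab G B | q.out ∈ ptStab G A}, (fun x => q.out⁻¹ • x) ⁻¹' S := by
    ext x
    simp only [Set.mem_iUnion, Set.mem_ofPred_eq, Set.mem_preimage, exists_prop]
    constructor
    · rintro ⟨k, hk, h⟩
      obtain ⟨q, j, hj, rfl⟩ := exists_eq_mul_out_inv B k
      rw [mul_smul, hS.2 j hj] at h
      refine ⟨q, ?_, h⟩
      have := mul_mem (inv_mem (ptStab_anti hAB hj)) hk
      rw [inv_mul_cancel_left] at this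
      exact inv_mem_iff.1 this
    · rintro ⟨q, hq, h⟩
      exact ⟨q.out⁻¹, inv_mem hq, h⟩
  rw [this]
  exact .biUnion (Set.to_countable _) fun q _ => measurable_const_smul _ hS.1

variable {μ : Measure X}

theorem ae_forall_smul [SMulInvariantMeasure G X μ] [MeasurableConstSMul G X] (A : Finset ℕ)
    {p : X → Prop} (hp : ∀ k ∈ ptStab G A, ∀ x, p x → p (k • x)) (h : ∀ᵐ x ∂μ, p x) :
    ∀ᵐ x ∂μ, ∀ g : G, p (g • x) := by
  have : ∀ᵐ x ∂μ, ∀ q : G ⧸ ptStab G A, p (q.out⁻¹ • x) :=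
    ae_all_iff.2 fun q => (measurePreserving_smul q.out⁻¹ μ).quasiMeasurePreserving.ae h
  filter_upwards [this] with x hx g
  obtain ⟨q, k, hk, rfl⟩ := exists_eq_mul_out_inv A g
  rw [mul_smul]
  exact hp k hk _ (hx q)

/-- A countable family dense among the strictly `G_A`-invariant sets has cells which are atoms. -/
theorem measure_cell_inter_or_sdiff {t 𝒮 : Set (Set X)}
    (hdense : ∀ Z ∈ 𝒮, ∀ ε : ℝ, 0 < ε → ∃ S ∈ t, μ (symmDiff Z S) < ENNReal.ofReal ε)
    {Z : Set X} (hZ : Z ∈ 𝒮) (x : X) : μ (cell t x ∩ Z) = 0 ∨ μ (cell t x \ Z) = 0 := by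
  by_contra! hcon
  obtain ⟨c, hc0, hc⟩ := ENNReal.lt_iff_exists_real_btwn.1
    (lt_min (pos_iff_ne_zero.2 hcon.1) (pos_iff_ne_zero.2 hcon.2))
  -- The whole cell lies on one side of S, so Z △ S contains either the part of the cell in Z or the
  -- part outside, each of measure more than c.
  obtain ⟨S, hS, hlt⟩ := hdense Z hZ c (ENNReal.ofReal_pos.1 hc.1)
  have hlt' := hlt.trans hc.2
  by_cases hx : x ∈ S
  · refine ((hlt'.trans_le (min_le_right _ _)).trans_le (measure_mono ?_)).false
    exact fun y hy => Or.inr ⟨(hy.1 S hS).2 hx, hy.2⟩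
  · refine ((hlt'.trans_le (min_le_left _ _)).trans_le (measure_mono ?_)).false
    exact fun y hy => Or.inl ⟨hy.2, fun h => hx ((hy.1 S hS).1 h)⟩

/-- If the stabilizers almost surely move `A` off itself, then the cells of a countable family of
strictly `G_A`-invariant sets almost surely have positive measure. -/
theorem ae_measure_cell_ne_zero [StandardBorelSpace X] [MeasurableSMul₂ G X]
    [IsProbabilityMeasure μ] [ErgodicSMul G X μ] (hG : DynamicallyDeFinetti G) {A : Finset ℕ}
    (hmove : ∀ᵐ x ∂μ, ∃ h ∈ MulAction.stabilizer G x, ∀ a ∈ A, h • a ∉ A)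
    {t : Set (Set X)} (htc : t.Countable) (ht : t ⊆ strictInv G X A) :
    ∀ᵐ x ∂μ, μ (cell t x) ≠ 0 := by
  classical
  have := htc.to_subtype
  have hτ : Measurable (cellMap t) := measurable_cellMap fun S hS => (ht hS).1
  let ν := μ.map (cellMap t)
  have : IsProbabilityMeasure ν := Measure.isProbabilityMeasure_map hτ.aemeasurable
  have hνs : ∀ x, ν {cellMap t x} = μ (cell t x) := fun x => by
    rw [Measure.map_apply hτ (measurableSet_singleton _), cell_eq_preimage]
  have hD : {s : t → Prop | 0 < ν {s}}.Countable :=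
    Measure.countable_meas_level_set_pos (μ := ν) measurable_id
  -- The types of x and h⁻¹x are invariant over A and hA, hence independent, with the same law ν.
  -- The part of the diagonal outside the atoms of ν is null for ν × ν.
  have key : ∀ h : G, (∀ a ∈ A, h • a ∉ A) →
      ∀ᵐ x ∂μ, cellMap t (h⁻¹ • x) = cellMap t x → μ (cell t x) ≠ 0 := by
    intro h hh
    have hτ' : Measurable fun x : X => cellMap t (h⁻¹ • x) := hτ.comp (measurable_const_smul h⁻¹)
    have hind : ProbabilityTheory.IndepFun (cellMap t) (fun x : X => cellMap t (h⁻¹ • x)) μ := by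
      refine ProbabilityTheory.indepFun_iff_measure_inter_preimage_eq_mul.2 fun U V hU hV => ?_
      refine measure_inter_of_disjoint hG (A := A) (B := A.image fun n => h • n) ?_
        (aeInv_of_preimage_eq (hτ hU).nullMeasurableSet fun g hg => ?_)
        (aeInv_of_preimage_eq (hτ' hV).nullMeasurableSet fun g hg => ?_)
      · rw [Finset.disjoint_right]
        intro n hn
        obtain ⟨a, ha, rfl⟩ := Finset.mem_image.1 hn
        exact hh a ha
      · ext x
        simp only [Set.mem_preimage, cellMap_smul ht hg]
      · ext x
        have hg' : h⁻¹ * g * h ∈ ptStab G A := mem_ptStab.2 fun n hn => by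
          rw [mul_smul, mul_smul, mem_ptStab.1 hg _ (Finset.mem_image_of_mem _ hn), inv_smul_smul]
        have := cellMap_smul ht hg' (h⁻¹ • x)
        rw [← mul_smul, mul_assoc, mul_inv_cancel, mul_one, mul_smul] at this
        simp only [Set.mem_preimage, this]
    have hmap := hind.map_prod_eq_prod_map_map hτ.aemeasurable hτ'.aemeasurable
    have hν' : μ.map (fun x : X => cellMap t (h⁻¹ • x)) = ν := by
      have := Measure.map_map (μ := μ) hτ (measurable_const_smul (α := X) h⁻¹)
      rw [(measurePreserving_smul h⁻¹ μ).map_eq] at this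
      exact this.symm
    rw [hν'] at hmap
    let Q : Set ((t → Prop) × (t → Prop)) := {p | p.2 = p.1} ∩ Prod.fst ⁻¹' {s | 0 < ν {s}}ᶜ
    have hQm : MeasurableSet Q :=
      (measurableSet_eq_fun measurable_snd measurable_fst).inter
        (measurable_fst hD.measurableSet.compl)
    have hQ : (ν.prod ν) Q = 0 := by
      rw [Measure.measure_prod_null hQm]
      refine Filter.Eventually.of_forall fun s => ?_
      by_cases hs : 0 < ν {s}
      · have : Prod.mk s ⁻¹' Q = ∅ := by
          ext s'; simp [Q, hs]
        simp [this]
      · refine measure_mono_null (t := {s}) (fun s' hs' => hs'.1) ?_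
        simpa using hs
    have hQ' := (ae_map_iff (hτ.prodMk hτ').aemeasurable hQm.compl).1
      (by rw [hmap]; exact measure_eq_zero_iff_ae_notMem.1 hQ)
    filter_upwards [hQ'] with x hx heq h0
    exact hx ⟨heq, by simp [hνs, h0]⟩
  have hall : ∀ᵐ x ∂μ, ∀ q : G ⧸ ptStab G A, (∀ a ∈ A, q.out • a ∉ A) →
      cellMap t (q.out⁻¹ • x) = cellMap t x → μ (cell t x) ≠ 0 := by
    refine ae_all_iff.2 fun q => ?_
    by_cases hq : ∀ a ∈ A, q.out • a ∉ A
    · filter_upwards [key q.out hq] with x hx _ using hx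
    · exact Filter.Eventually.of_forall fun x h => absurd h hq
  filter_upwards [hall, hmove] with x hx ⟨h, hhx, hhA⟩
  obtain ⟨q, k, hk, rfl⟩ := exists_eq_out_mul A h
  refine hx q (fun a ha => ?_) ?_
  · have := hhA a ha
    rwa [mul_smul, mem_ptStab.1 hk a ha] at this
  · have h1 : (q.out * k)⁻¹ • x = x := (inv_mem hhx : _ ∈ MulAction.stabilizer G x)
    conv_rhs => rw [← h1, mul_inv_rev, mul_smul, cellMap_smul ht (inv_mem hk)]

/-- A finite measure has only countably many disjoint cells of positive measure; one representative
of each is chosen. -/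
theorem countable_cells [IsFiniteMeasure μ] {t : Set (Set X)} (htc : t.Countable)
    (ht : ∀ S ∈ t, MeasurableSet S) :
    ∃ r : Set X, r.Countable ∧ ∀ x, μ (cell t x) ≠ 0 → ∃ y ∈ r, x ∈ cell t y := by
  have := htc.to_subtype
  have hD : {s : t → Prop | 0 < μ {x | cellMap t x = s}}.Countable :=
    Measure.countable_meas_level_set_pos (μ := μ) (measurable_cellMap ht)
  let D := {s : t → Prop | 0 < μ {x | cellMap t x = s}} ∩ Set.range (cellMap t)
  rcases isEmpty_or_nonempty X with hX | hX
  · exact ⟨∅, Set.countable_empty, fun x => hX.elim x⟩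
  have hs : ∀ s ∈ D, ∃ x, cellMap t x = s := fun s hs => hs.2
  choose! F hF using hs
  refine ⟨F '' D, (hD.mono Set.inter_subset_left).image F, fun x hx => ?_⟩
  have hxD : cellMap t x ∈ D := by
    refine ⟨?_, x, rfl⟩
    rw [cell_eq_preimage] at hx
    exact pos_iff_ne_zero.2 hx
  refine ⟨_, ⟨_, hxD, rfl⟩, ?_⟩
  rw [cell_eq_preimage]
  exact (hF _ hxD).symm

end Cells

/-! ### Back-and-forth between types. -/

section BackAndForth

/-- Points of a system of relations with the back-and-forth property are matched, on every finite
set, by an element of the closed group `G`. -/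
theorem exists_limit_of_backAndForth {G : Subgroup (Equiv.Perm ℕ)}
    (hclosed : IsClosed (G : Set (Equiv.Perm ℕ))) (R : Finset ℕ → G → G → Prop)
    (h0 : R ∅ 1 1)
    (hforth : ∀ f g : G, ∀ A B : Finset ℕ, A ⊆ B → R A f g → ∃ k ∈ ptStab G A, R B f (k * g))
    (hback : ∀ f g : G, ∀ A B : Finset ℕ, A ⊆ B → R A f g → ∃ k ∈ ptStab G A, R B (k * f) g) :
    ∃ h : G, ∀ s : Finset ℕ, ∃ A f g, R A f g ∧ ∀ n ∈ s, f • n ∈ A ∧ g • h • n = f • n := by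
  classical
  let σ : Type := {p : Finset ℕ × G × G // R p.1 p.2.1 p.2.2}
  have step : ∀ (p : σ) (n : ℕ), ∃ q : σ, p.1.1 ⊆ q.1.1 ∧
      (∀ m, p.1.2.1 • m ∈ p.1.1 → q.1.2.1 • m = p.1.2.1 • m) ∧
      (∀ m, p.1.2.2 • m ∈ p.1.1 → q.1.2.2 • m = p.1.2.2 • m) ∧
      q.1.2.1 • n ∈ q.1.1 ∧ q.1.2.2 • n ∈ q.1.1 := by
    rintro ⟨⟨A, f, g⟩, hp⟩ n
    -- First f n enters the set and g is corrected; then the new g n enters and f is corrected. The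
    -- second correction fixes the enlarged set, so f n stays put.
    obtain ⟨k, hk, hR⟩ := hforth f g A (insert (f • n) A) (Finset.subset_insert _ _) hp
    obtain ⟨j, hj, hR'⟩ := hback f (k * g) _ (insert ((k * g) • n) (insert (f • n) A))
      (Finset.subset_insert _ _) hR
    have hjA : ∀ m ∈ insert (f • n) A, j • m = m := mem_ptStab.1 hj
    refine ⟨⟨(_, j * f, k * g), hR'⟩, fun m hm => by simp [hm], fun m hm => ?_, fun m hm => ?_,
      ?_, ?_⟩
    · exact (mul_smul j f m).trans (hjA _ (Finset.mem_insert_of_mem hm))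
    · exact (mul_smul k g m).trans (mem_ptStab.1 hk _ hm)
    · change (j * f) • n ∈ insert ((k * g) • n) (insert (f • n) A)
      rw [mul_smul j f, hjA _ (Finset.mem_insert_self _ _)]
      simp
    · exact Finset.mem_insert_self _ _
  choose next hsub hf hg hfn hgn using step
  let p : ℕ → σ := fun n => Nat.rec ⟨(∅, 1, 1), h0⟩ (fun n q => next q n) n
  have hp : ∀ n, p (n + 1) = next (p n) n := fun _ => rfl
  have hmono : Monotone fun n => (p n).1.1 := monotone_nat_of_le_succ fun n => by
    rw [hp]
    exact hsub _ _
  have hfs : ∀ n m, n < m → (p m).1.2.1 • n ∈ (p m).1.1 ∧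
      (p m).1.2.1 • n = (p (n + 1)).1.2.1 • n := by
    intro n m hnm
    induction m, hnm using Nat.le_induction with
    | base => exact ⟨by rw [hp]; exact hfn _ _, rfl⟩
    | succ m hm ih =>
      have h1 : (p (m + 1)).1.2.1 • n = (p m).1.2.1 • n := by rw [hp]; exact hf _ _ _ ih.1
      exact ⟨by rw [h1]; exact hmono m.le_succ ih.1, h1.trans ih.2⟩
  have hgs : ∀ n m, n < m → (p m).1.2.2 • n ∈ (p m).1.1 ∧
      (p m).1.2.2 • n = (p (n + 1)).1.2.2 • n := by
    intro n m hnm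
    induction m, hnm using Nat.le_induction with
    | base => exact ⟨by rw [hp]; exact hgn _ _, rfl⟩
    | succ m hm ih =>
      have h1 : (p (m + 1)).1.2.2 • n = (p m).1.2.2 • n := by rw [hp]; exact hg _ _ _ ih.1
      exact ⟨by rw [h1]; exact hmono m.le_succ ih.1, h1.trans ih.2⟩
  -- once a point enters the finite set, its preimage under either component is constant
  have hfi : ∀ a n m, n ≤ m → a ∈ (p n).1.1 → (p m).1.2.1⁻¹ • a = (p n).1.2.1⁻¹ • a := by
    intro a n m hnm ha
    induction m, hnm using Nat.le_induction with
    | base => rfl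
    | succ m hm ih =>
      rw [← ih, inv_smul_eq_iff, hp, hf _ _ _ (by rw [smul_inv_smul]; exact hmono hm ha),
        smul_inv_smul]
  have hgi : ∀ a n m, n ≤ m → a ∈ (p n).1.1 → (p m).1.2.2⁻¹ • a = (p n).1.2.2⁻¹ • a := by
    intro a n m hnm ha
    induction m, hnm using Nat.le_induction with
    | base => rfl
    | succ m hm ih =>
      rw [← ih, inv_smul_eq_iff, hp, hg _ _ _ (by rw [smul_inv_smul]; exact hmono hm ha),
        smul_inv_smul]
  -- The limits of g⁻¹f and f⁻¹g; their values at n are settled from stage n + 1 on.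
  let u : ℕ → ℕ := fun n => (p (n + 1)).1.2.2⁻¹ • (p (n + 1)).1.2.1 • n
  let v : ℕ → ℕ := fun n => (p (n + 1)).1.2.1⁻¹ • (p (n + 1)).1.2.2 • n
  have hu : ∀ n m, n < m → (p m).1.2.2 • u n = (p m).1.2.1 • n := by
    intro n m hnm
    rw [← eq_inv_smul_iff, (hfs n m hnm).2,
      hgi _ (n + 1) m hnm (hfs n (n + 1) n.lt_succ_self).1]
  have hv : ∀ n m, n < m → (p m).1.2.1 • v n = (p m).1.2.2 • n := by
    intro n m hnm
    rw [← eq_inv_smul_iff, (hgs n m hnm).2,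
      hfi _ (n + 1) m hnm (hgs n (n + 1) n.lt_succ_self).1]
  let h : Equiv.Perm ℕ :=
    { toFun := u
      invFun := v
      left_inv := fun n => by
        have h1 := hu n (n + u n + 1) (by omega)
        have h2 := hv (u n) (n + u n + 1) (by omega)
        rw [h1] at h2
        exact smul_left_cancel _ h2
      right_inv := fun n => by
        have h1 := hv n (n + v n + 1) (by omega)
        have h2 := hu (v n) (n + v n + 1) (by omega)
        rw [h1] at h2
        exact smul_left_cancel _ h2 }
  have hbound : ∀ s : Finset ℕ, ∃ m, ∀ n ∈ s, n < m := fun s =>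
    ⟨s.sup id + 1, fun n hn => Nat.lt_succ_of_le (Finset.le_sup (f := id) hn)⟩
  have hG : h ∈ G := mem_of_forall_finset hclosed h fun s => by
    obtain ⟨m, hm⟩ := hbound s
    refine ⟨((p m).1.2.2⁻¹ * (p m).1.2.1 : G), SetLike.coe_mem _, fun n hn => ?_⟩
    change ((p m).1.2.2⁻¹ * (p m).1.2.1) • n = u n
    rw [mul_smul, inv_smul_eq_iff, hu n m (hm n hn)]
  refine ⟨⟨h, hG⟩, fun s => ?_⟩
  obtain ⟨m, hm⟩ := hbound s
  exact ⟨_, _, _, (p m).2, fun n hn => ⟨(hfs n m (hm n hn)).1, hu n m (hm n hn)⟩⟩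

variable {G : Subgroup (Equiv.Perm ℕ)} {X : Type} [MulAction G X] [MeasurableSpace X]
  {μ : Measure X} [MeasurableSMul₂ G X] [IsProbabilityMeasure μ]

/-- If the cells of `u` are atoms among the strictly `G_A`-invariant sets, then almost every point
of a cell of `u` extends to a given cell of `v` that meets it in positive measure. -/
theorem ae_exists_smul_mem_cell {A B : Finset ℕ} (hAB : A ⊆ B) {u v : Set (Set X)}
    (huc : u.Countable) (hu : u ⊆ strictInv G X A) (hvc : v.Countable) (hv : v ⊆ strictInv G X B)
    (hdense : ∀ Z ∈ strictInv G X A, ∀ ε : ℝ, 0 < ε →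
      ∃ S ∈ u, μ (symmDiff Z S) < ENNReal.ofReal ε) :
    ∀ᵐ x ∂μ, ∀ y, μ (cell (u ∪ v) y) ≠ 0 → x ∈ cell u y →
      ∃ k ∈ ptStab G A, k • x ∈ cell v y := by
  obtain ⟨r, hr, hcov⟩ := countable_cells (μ := μ) (huc.union hvc) (t := u ∪ v)
    (fun S hS => hS.elim (fun h => (hu h).1) fun h => (hv h).1)
  have hone : ∀ᵐ x ∂μ, ∀ y ∈ r, μ (cell (u ∪ v) y) ≠ 0 → x ∈ cell u y →
      ∃ k ∈ ptStab G A, k • x ∈ cell v y := by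
    refine (ae_ball_iff hr).2 fun y _ => ?_
    by_cases hy : μ (cell (u ∪ v) y) = 0
    · exact Filter.Eventually.of_forall fun x h => absurd hy h
    -- The points that G_A can move into the cell of v form a G_A-invariant set. It meets the atom
    -- `cell u y` in positive measure, so it contains almost all of it.
    have hZ := strictInv_orbit_mem hAB (cell_mem_strictInv hvc hv y)
    have h0 := (measure_cell_inter_or_sdiff hdense hZ y).resolve_left fun h => hy <| by
      refine measure_mono_null (fun x hx => ?_) h
      rw [cell_union] at hx
      exact ⟨hx.1, 1, one_mem _, by simpa using hx.2⟩
    filter_upwards [measure_eq_zero_iff_ae_notMem.1 h0] with x hx _ hxy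
    exact by_contra fun h => hx ⟨hxy, h⟩
  filter_upwards [hone] with x hx y hy hxy
  obtain ⟨z, hz, hyz⟩ := hcov y hy
  have h1 := cell_eq_of_mem hyz
  have h2 := cell_eq_of_mem (cell_mono Set.subset_union_left z hyz)
  have h3 := cell_eq_of_mem (cell_mono Set.subset_union_right z hyz)
  rw [h1] at hy
  rw [h2] at hxy
  rw [h3]
  exact hx z hz hy hxy

variable [StandardBorelSpace X] [ErgodicSMul G X μ]

/-- If almost all stabilizers have no finite orbits, then almost all points are related by a
system of relations with the back-and-forth property. -/
theorem exists_backAndForth (hG : DynamicallyDeFinetti G)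
    (hinf : ∀ᵐ x ∂μ, ∀ a : ℕ, (MulAction.orbit (MulAction.stabilizer G x) a).Infinite)
    (ℬ : Finset ℕ → Set (Set X)) (hℬc : ∀ A, (ℬ A).Countable)
    (hℬ : ∀ A, ℬ A ⊆ strictInv G X A) :
    ∃ t : Finset ℕ → Set (Set X), (∀ A, ℬ A ⊆ t A) ∧ ∃ X₀ : Set X, (∀ᵐ x ∂μ, x ∈ X₀) ∧
      (∀ x ∈ X₀, ∀ y ∈ X₀, y ∈ cell (t ∅) x) ∧
      ∀ x ∈ X₀, ∀ y ∈ X₀, ∀ f g : G, ∀ A B : Finset ℕ, A ⊆ B → g • y ∈ cell (t A) (f • x) →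
        ∃ k ∈ ptStab G A, k • g • y ∈ cell (t B) (f • x) := by
  choose d hd hdc hdense using fun A =>
    exists_countable_dense_subfamily μ (strictInv G X A) fun S hS => hS.1
  -- The dense part `d A` makes cells atoms; `ℬ A` carries the prescribed sets that the cells must
  -- decide.
  let t : Finset ℕ → Set (Set X) := fun A => d A ∪ ℬ A
  have htc : ∀ A, (t A).Countable := fun A => (hdc A).union (hℬc A)
  have ht : ∀ A, t A ⊆ strictInv G X A := fun A => Set.union_subset (hd A) (hℬ A)
  have htd : ∀ A, ∀ Z ∈ strictInv G X A, ∀ ε : ℝ, 0 < ε →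
      ∃ S ∈ t A, μ (symmDiff Z S) < ENNReal.ofReal ε := fun A Z hZ ε hε => by
    obtain ⟨S, hS, h⟩ := hdense A Z hZ ε hε
    exact ⟨S, Or.inl hS, h⟩
  have hmove : ∀ A : Finset ℕ, ∀ᵐ x ∂μ, ∃ h ∈ MulAction.stabilizer G x, ∀ a ∈ A, h • a ∉ A := by
    intro A
    filter_upwards [hinf] with x hx
    obtain ⟨h, hh⟩ := exists_smul_notMem hx A
    exact ⟨h, h.2, hh⟩
  have hpos : ∀ A B : Finset ℕ, A ⊆ B → ∀ᵐ x ∂μ, ∀ g : G, μ (cell (t A ∪ t B) (g • x)) ≠ 0 := by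
    intro A B hAB
    have hsub : t A ∪ t B ⊆ strictInv G X B :=
      Set.union_subset ((ht A).trans (strictInv_mono hAB)) (ht B)
    refine ae_forall_smul B (fun k hk x hx => ?_)
      (ae_measure_cell_ne_zero hG (hmove B) ((htc A).union (htc B)) hsub)
    rwa [cell_smul hsub hk]
  have hext : ∀ A B : Finset ℕ, A ⊆ B → ∀ᵐ x ∂μ, ∀ g : G, ∀ y, μ (cell (t A ∪ t B) y) ≠ 0 →
      g • x ∈ cell (t A) y → ∃ k ∈ ptStab G A, k • g • x ∈ cell (t B) y := by
    intro A B hAB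
    refine ae_forall_smul (p := fun x => ∀ y, μ (cell (t A ∪ t B) y) ≠ 0 → x ∈ cell (t A) y →
      ∃ k ∈ ptStab G A, k • x ∈ cell (t B) y) A (fun k hk x hx y hy hxy => ?_)
      (ae_exists_smul_mem_cell hAB (htc A) (ht A) (htc B) (ht B) (htd A))
    obtain ⟨j, hj, h⟩ := hx y hy ((smul_mem_cell (ht A) hk).1 hxy)
    exact ⟨j * k⁻¹, mul_mem hj (inv_mem hk), by rwa [mul_smul, inv_smul_smul]⟩
  refine ⟨t, fun A => Set.subset_union_right,
    {x | ∀ A B : Finset ℕ, A ⊆ B → ∀ g : G, μ (cell (t A ∪ t B) (g • x)) ≠ 0 ∧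
      ∀ y, μ (cell (t A ∪ t B) y) ≠ 0 → g • x ∈ cell (t A) y →
        ∃ k ∈ ptStab G A, k • g • x ∈ cell (t B) y}, ?_, ?_, ?_⟩
  · refine ae_all_iff.2 fun A => ae_all_iff.2 fun B => ?_
    by_cases hAB : A ⊆ B
    · filter_upwards [hpos A B hAB, hext A B hAB] with x h1 h2 _ g using ⟨h1 g, h2 g⟩
    · exact Filter.Eventually.of_forall fun x h => absurd h hAB
  -- A cell over ∅ is G-invariant, so positive measure makes it conull by ergodicity; any two conull
  -- cells meet and hence coincide.
  · have hfull : ∀ x, μ (cell (t ∅ ∪ t ∅) ((1 : G) • x)) ≠ 0 → ∀ᵐ z ∂μ, z ∈ cell (t ∅) x := by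
      intro x hx
      rw [Set.union_self, one_smul] at hx
      have hs := cell_mem_strictInv (htc ∅) (ht ∅) x
      have hc := aeconst_of_forall_preimage_smul_ae_eq G (μ := μ) hs.1.nullMeasurableSet fun g => by
        refine Filter.EventuallyEq.of_eq (Set.ext fun z => ?_)
        exact hs.2 g (mem_ptStab.2 (by simp)) z
      rcases Filter.eventuallyConst_set.1 hc with h | h
      · exact h
      · exact absurd (measure_eq_zero_iff_ae_notMem.2 h) hx
    intro x hx y hy
    obtain ⟨z, hzx, hzy⟩ := ((hfull x (hx ∅ ∅ subset_rfl 1).1).and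
      (hfull y (hy ∅ ∅ subset_rfl 1).1)).exists
    rw [← cell_eq_of_mem hzx, cell_eq_of_mem hzy]
    exact mem_cell_self _ _
  · intro x hx y hy f g A B hAB h
    exact (hy A B hAB g).2 _ (hx A B hAB f).1 h

end BackAndForth

/-! ### Application to the space of expansions. -/

section Structures

theorem isOpen_setOf_inv_apply_eq (n m : ℕ) : IsOpen {g : Equiv.Perm ℕ | g⁻¹ n = m} := by
  have : {g : Equiv.Perm ℕ | g⁻¹ n = m} = (fun g => g m) ⁻¹' {n} := by
    ext g
    exact Equiv.Perm.inv_eq_iff_eq.trans eq_comm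
  rw [this]
  exact (isOpen_discrete _).preimage (continuous_apply_perm m)

theorem measurable_inv_apply (n : ℕ) : Measurable fun g : Equiv.Perm ℕ => g⁻¹ n :=
  measurable_to_countable' fun m => (isOpen_setOf_inv_apply_eq n m).measurableSet

variable {G : Subgroup (Equiv.Perm ℕ)} {L : FirstOrder.Language.{0, 0}}
  (φ : FirstOrder.Language.LHom (canonicalLanguage G) L)

theorem measurable_relation {r : ℕ} (R : L.Relations r) (x : Fin r → ℕ) :
    Measurable fun M : GStruc φ => M.1 r R x := by
  have h : Measurable fun M : ∀ (r : ℕ) (_ : L.Relations r), (Fin r → ℕ) → Bool => M r R x := by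
    fun_prop
  exact h.comp measurable_subtype_coe

theorem measurable_relation_comp {α : Type*} [MeasurableSpace α] {r : ℕ} (R : L.Relations r)
    {f : α → GStruc φ} (hf : Measurable f) {x : α → Fin r → ℕ} (hx : Measurable x) :
    Measurable fun a => (f a).1 r R (x a) := by
  have : Measurable fun p : (Fin r → ℕ) × GStruc φ => p.2.1 r R p.1 :=
    measurable_from_prod_countable_right fun y => measurable_relation φ R y
  exact this.comp (hx.prodMk hf)

theorem measurable_of_relation {α : Type*} [MeasurableSpace α] {f : α → GStruc φ}
    (hf : ∀ r (R : L.Relations r) (x : Fin r → ℕ), Measurable fun a => (f a).1 r R x) :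
    Measurable f :=
  Measurable.subtype_mk (measurable_pi_lambda _ fun r => measurable_pi_lambda _ fun R =>
    measurable_pi_lambda _ fun x => hf r R x)

instance : MeasurableSMul₂ G (GStruc φ) where
  measurable_smul := measurable_of_relation φ fun r R x => by
    refine measurable_relation_comp φ R (f := Prod.snd)
      (x := fun p i => ((p.1 : G) : Equiv.Perm ℕ)⁻¹ (x i)) measurable_snd ?_
    exact measurable_pi_lambda _ fun i =>
      (measurable_inv_apply (x i)).comp (measurable_subtype_coe.comp measurable_fst)

theorem isClosed_setOf_reduct_eq : IsClosed {M : Struc L | reduct φ M = canonicalStructure G} := by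
  have : {M : Struc L | reduct φ M = canonicalStructure G} = ⋂ (r : ℕ)
      (R : (canonicalLanguage G).Relations r) (x : Fin r → ℕ),
      (fun M : Struc L => M r (φ.onRelation R) x) ⁻¹' {canonicalStructure G r R x} := by
    ext M
    simp only [Set.mem_iInter, Set.mem_preimage, Set.mem_singleton_iff, Set.mem_ofPred_eq]
    exact ⟨fun h r R x => by rw [← h]; rfl, fun h => by funext r R x; exact h r R x⟩
  rw [this]
  refine isClosed_iInter fun r => isClosed_iInter fun R => isClosed_iInter fun x => ?_
  exact isClosed_singleton.preimage ((continuous_apply x).comp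
    ((continuous_apply (φ.onRelation R)).comp (continuous_apply r)))

/-- A permutation preserving an expansion of the canonical structure of a closed group `G` belongs
to `G`. -/
theorem aut_le (hclosed : IsClosed (G : Set (Equiv.Perm ℕ))) (M : GStruc φ) :
    Struc.aut M.1 ≤ G := by
  intro h hh
  have hcan : h • canonicalStructure G = canonicalStructure G := by
    rw [← M.2]
    change reduct φ (h • M.1) = _
    rw [show h • M.1 = M.1 from hh]
  refine mem_of_forall_finset hclosed h fun s => ?_
  obtain ⟨m, hm⟩ : ∃ m, ∀ n ∈ s, n < m + 1 :=
    ⟨s.sup id, fun n hn => Nat.lt_succ_of_le (Finset.le_sup (f := id) hn)⟩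
  -- The tuple (0, …, m) enumerates a set containing s. As h preserves the symbol of its orbit, some
  -- element of G agrees with h on it.
  let x : Fin (m + 1) → ℕ := fun i => i
  let R : MulAction.orbitRel.Quotient G (Fin (m + 1) → ℕ) := Quotient.mk'' x
  have hx : canonicalStructure G (m + 1) R (fun i => h⁻¹ (h (x i))) =
      canonicalStructure G (m + 1) R fun i => h (x i) :=
    congrFun (congrFun (congrFun hcan (m + 1)) R) fun i => h (x i)
  simp only [canonicalStructure, Equiv.Perm.inv_def, Equiv.symm_apply_apply, decide_eq_decide,
    MulAction.orbitRel.Quotient.mem_orbit] at hx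
  obtain ⟨g, hg⟩ := Quotient.exact' (hx.1 rfl)
  exact ⟨g, g.2, fun n hn => congrFun hg ⟨n, hm n hn⟩⟩

theorem stabilizer_eq_aut_comap (M : GStruc φ) :
    MulAction.stabilizer G M = (Struc.aut M.1).comap G.subtype := by
  ext g
  exact Subtype.ext_iff

theorem mem_aut_iff {M : Struc L} {h : Equiv.Perm ℕ} :
    h ∈ Struc.aut M ↔ ∀ r (R : L.Relations r) (x : Fin r → ℕ), M r R (fun i => h (x i)) = M r R x := by
  change h • M = M ↔ _
  constructor
  · intro H r R x
    conv_lhs => rw [← H, Struc.smul_apply]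
    simp
  · intro H
    funext r R x
    rw [Struc.smul_apply, ← H]
    simp

/-- Coding a permutation as a pair of mutually inverse functions exhibits the move set as a
projection from a Polish product. Membership in G needs no clause, as automorphisms lie in G. -/
theorem moveSet_eq_image (hclosed : IsClosed (G : Set (Equiv.Perm ℕ))) (a b : ℕ) :
    moveSet G (GStruc φ) a b = Prod.snd '' {p : ((ℕ → ℕ) × (ℕ → ℕ)) × GStruc φ |
      (∀ n, p.1.1 (p.1.2 n) = n) ∧ (∀ n, p.1.2 (p.1.1 n) = n) ∧ p.1.1 a = b ∧
      ∀ r (R : L.Relations r) (x : Fin r → ℕ), p.2.1 r R (fun i => p.1.1 (x i)) = p.2.1 r R x} := by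
  ext M
  constructor
  · rintro ⟨h, hM, hab⟩
    rw [stabilizer_eq_aut_comap] at hM
    exact ⟨((h.1, h.1.symm), M), ⟨h.1.apply_symm_apply, h.1.symm_apply_apply, hab,
      mem_aut_iff.1 hM⟩, rfl⟩
  · rintro ⟨⟨⟨u, v⟩, M⟩, ⟨huv, hvu, hab, hM⟩, rfl⟩
    let h : Equiv.Perm ℕ := ⟨u, v, hvu, huv⟩
    have hh : h ∈ Struc.aut M.1 := mem_aut_iff.2 hM
    refine ⟨⟨h, aut_le φ hclosed M hh⟩, ?_, hab⟩
    rw [stabilizer_eq_aut_comap]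
    exact hh

/-- The basic sets of structures given by a relation symbol and a tuple of elements of `A`. -/
def basicSets (A : Finset ℕ) : Set (Set (GStruc φ)) :=
  {S | ∃ (r : ℕ) (R : L.Relations r) (x : Fin r → ℕ), (∀ i, x i ∈ A) ∧ S = {M | M.1 r R x = true}}

theorem basicSets_subset_strictInv (A : Finset ℕ) :
    basicSets φ A ⊆ strictInv G (GStruc φ) A := by
  rintro _ ⟨r, R, x, hx, rfl⟩
  refine ⟨measurable_relation φ R x (measurableSet_singleton true), fun g hg M => ?_⟩
  have : (fun i => (g : Equiv.Perm ℕ)⁻¹ (x i)) = x :=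
    funext fun i => mem_ptStab.1 (inv_mem hg) _ (hx i)
  change M.1 r R (fun i => (g : Equiv.Perm ℕ)⁻¹ (x i)) = true ↔ M.1 r R x = true
  rw [this]

variable [∀ r, Countable (L.Relations r)]

theorem countable_basicSets (A : Finset ℕ) : (basicSets φ A).Countable := by
  refine (Set.countable_range fun p : Σ r, L.Relations r × (Fin r → ℕ) =>
    {M : GStruc φ | M.1 p.1 p.2.1 p.2.2 = true}).mono ?_
  rintro _ ⟨r, R, x, -, rfl⟩
  exact ⟨⟨r, R, x⟩, rfl⟩

instance : PolishSpace (Struc L) :=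
  { toSecondCountableTopology := inferInstanceAs
      (SecondCountableTopology (∀ (r : ℕ) (_ : L.Relations r), (Fin r → ℕ) → Bool))
    toIsCompletelyMetrizableSpace := inferInstanceAs
      (TopologicalSpace.IsCompletelyMetrizableSpace
        (∀ (r : ℕ) (_ : L.Relations r), (Fin r → ℕ) → Bool)) }

instance : PolishSpace (GStruc φ) := (isClosed_setOf_reduct_eq φ).polishSpace

theorem analyticSet_moveSet (hclosed : IsClosed (G : Set (Equiv.Perm ℕ))) (a b : ℕ) :
    AnalyticSet (moveSet G (GStruc φ) a b) := by
  rw [moveSet_eq_image φ hclosed]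
  refine MeasurableSet.analyticSet_image ?_ measurable_snd
  have h1 : ∀ n, Measurable fun p : ((ℕ → ℕ) × (ℕ → ℕ)) × GStruc φ => p.1.1 n := fun n =>
    (measurable_pi_apply n).comp measurable_fst.fst
  have h2 : ∀ n, Measurable fun p : ((ℕ → ℕ) × (ℕ → ℕ)) × GStruc φ => p.1.2 n := fun n =>
    (measurable_pi_apply n).comp measurable_fst.snd
  have heval : Measurable fun q : ℕ × (ℕ → ℕ) => q.2 q.1 :=
    measurable_from_prod_countable_right fun n => measurable_pi_apply n
  simp only [Set.ofPred_and, Set.ofPred_forall]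
  refine .inter (.iInter fun n => ?_) (.inter (.iInter fun n => ?_)
    (.inter ?_ (.iInter fun r => .iInter fun R => .iInter fun x => ?_)))
  · exact measurableSet_eq_fun (heval.comp ((h2 n).prodMk measurable_fst.fst)) measurable_const
  · exact measurableSet_eq_fun (heval.comp ((h1 n).prodMk measurable_fst.snd)) measurable_const
  · exact measurableSet_eq_fun (h1 a) measurable_const
  · exact measurableSet_eq_fun
      (measurable_relation_comp φ R measurable_snd (measurable_pi_lambda _ fun i => h1 (x i)))
      (measurable_relation_comp φ R measurable_snd measurable_const)

variable {φ}

/-- Two typical structures M and N are compared by asking that f M and g N have the same type over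
A. Types decide the basic sets over A, so the limit of g⁻¹f carries M to N. -/
theorem concentratedOnOrbit_of_infinite_orbit {μ : Measure (GStruc φ)} [IsProbabilityMeasure μ]
    [ErgodicSMul G (GStruc φ) μ] (hclosed : IsClosed (G : Set (Equiv.Perm ℕ)))
    (hG : DynamicallyDeFinetti G)
    (hinf : ∀ᵐ M ∂μ, ∀ a : ℕ, (MulAction.orbit (MulAction.stabilizer G M) a).Infinite) :
    ConcentratedOnOrbit φ μ := by
  obtain ⟨t, hBt, X₀, hX₀, h0, hstep⟩ := exists_backAndForth hG hinf (basicSets φ)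
    (countable_basicSets φ) (basicSets_subset_strictInv φ)
  obtain ⟨M, hM⟩ := hX₀.exists
  refine ⟨M, ?_⟩
  filter_upwards [hX₀] with N hN
  obtain ⟨h, hh⟩ := exists_limit_of_backAndForth hclosed
    (fun A f g => g • N ∈ cell (t A) (f • M))
    (by simpa using h0 M hM N hN)
    (fun f g A B hAB hR => by simpa only [mul_smul] using hstep M hM N hN f g A B hAB hR)
    (fun f g A B hAB hR => by
      obtain ⟨k, hk, hR'⟩ := hstep N hN M hM g f A B hAB (mem_cell_comm.1 hR)
      exact ⟨k, hk, by rw [mul_smul]; exact mem_cell_comm.1 hR'⟩)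
  refine ⟨h, Subtype.ext ?_⟩
  funext r R x
  -- The finite set is chosen so that the tuples f h⁻¹x and g x coincide inside A, where f M and g N
  -- satisfy the same relations.
  obtain ⟨A, f, g, hR, hs⟩ := hh (Finset.univ.image fun i => h⁻¹ • x i)
  have hs' : ∀ i, f • h⁻¹ • x i ∈ A ∧ g • x i = f • h⁻¹ • x i := fun i => by
    have := hs (h⁻¹ • x i) (Finset.mem_image_of_mem _ (Finset.mem_univ i))
    rwa [smul_inv_smul] at this
  have hiff := hR _ (hBt A ⟨r, R, fun i => g • x i, fun i => by
    change g • x i ∈ A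
    rw [(hs' i).2]
    exact (hs' i).1, rfl⟩)
  have hN' : (g • N).1 r R (fun i => g • x i) = N.1 r R x := by
    change N.1 r R (fun i => g⁻¹ • g • x i) = _
    simp only [inv_smul_smul]
  have hM' : (f • M).1 r R (fun i => g • x i) = M.1 r R (fun i => h⁻¹ • x i) := by
    change M.1 r R (fun i => f⁻¹ • g • x i) = _
    simp only [(hs' _).2, inv_smul_smul]
  have hiff' : (g • N).1 r R (fun i => g • x i) = true ↔
    (f • M).1 r R (fun i => g • x i) = true := hiff
  rw [hN', hM'] at hiff'
  change M.1 r R (fun i => h⁻¹ • x i) = N.1 r R x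
  exact (Bool.eq_iff_iff.2 hiff').symm

end Structures

end IRE

theorem mainTheorem2 (G : Subgroup (Equiv.Perm ℕ))
    (hclosed : IsClosed (G : Set (Equiv.Perm ℕ)))
    (hproper : G ≠ ⊤)
    (htrans : MulAction.IsPretransitive G ℕ)
    (hG : IRE.DynamicallyDeFinetti G)
    (L : FirstOrder.Language.{0, 0}) (hrel : L.IsRelational)
    (hcount : ∀ r, Countable (L.Relations r))
    (φ : FirstOrder.Language.LHom (IRE.canonicalLanguage G) L) (hφ : φ.Injective)
    (μ : MeasureTheory.Measure (IRE.GStruc φ)) (hμ : IRE.IsIRE φ μ)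
    (herg : ErgodicSMul G (IRE.GStruc φ) μ) :
    (∀ᵐ M ∂μ, IRE.Struc.aut M.1 = ⊥) ∨ IRE.ConcentratedOnOrbit φ μ := by
  have := hμ.isProbabilityMeasure
  refine (IRE.ae_stabilizer_eq_bot_or_infinite_orbit hclosed hproper htrans hG fun a b =>
    IRE.nullMeasurableSet_of_analyticSet μ (IRE.analyticSet_moveSet φ hclosed a b)).imp
    (fun h => ?_) (IRE.concentratedOnOrbit_of_infinite_orbit hclosed hG)
  filter_upwards [h] with M hM
  refine (Subgroup.eq_bot_iff_forall _).2 fun h hh => ?_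
  have h1 : (⟨h, IRE.aut_le φ hclosed M hh⟩ : G) ∈ MulAction.stabilizer G M := by
    rw [IRE.stabilizer_eq_aut_comap]
    exact hh
  rw [hM, Subgroup.mem_bot] at h1
  exact congrArg Subtype.val h1
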